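/- Let $m,N\in\mathbb N$. For a multi-index $\mathbf n=(n_1,\dots,n_m)\in\mathbb N^m$ let $|\mathbf n\rangle$ be the Fock basis vectors of $m$ bosonic modes, with the annihilation and creation operators $a_k|\mathbf n\rangle=\sqrt{n_k}\,|\dots,n_k-1,\dots\rangle$ and $a_k^\dagger|\mathbf n\rangle=\sqrt{n_k+1}\,|\dots,n_k+1,\dots\rangle$. Let $\mathcal H_m^{\le N}$ be the finite-dimensional complex Hilbert space with orthonormal basis $\{|\mathbf n\rangle : n_1+\dots+n_m\le N\}$. Let $H_1,\dots,H_d$ ($d=m^2$) be the Hamiltonians of passive linear optics, i.e. $$e_{kl}=\tfrac12(a_k^\dagger a_l+a_l^\dagger a_k),\qquad E_{kl}=\tfrac i2(a_k^\dagger a_l-a_l^\dagger a_k)\quad(1\le k<l\le m),\qquad N_k=a_k^\dagger a_k\quad(1\le k\le m);$$ they preserve the total photon number, hence restrict to $\mathcal H_m^{\le N}$. Let $G=\{e^{-it_1H_{I_1}}\cdots e^{-it_aH_{I_a}} : a\in\mathbb N,\ t_j\in\mathbb R,\ 1\le I_j\le d\}$ be the group of unitaries of $\mathcal H_m^{\le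 N}$ that they generate. For every unit vector $|\psi\rangle\in\mathcal H_m^{\le N}$ and every density operator $\rho$ on $\mathcal H_m^{\le N}$ (non-negative, $\operatorname{Tr}\rho=1$): 1. The orbit $\operatorname{Orb}_G(|\psi\rangle)=\{U|\psi\rangle : U\in G\}$, with the norm topology, is a smooth embedded submanifold of $\mathcal H_m^{\le N}$ (regarded as a real vector space), of dimension $$\dim\operatorname{Orb}_G(|\psi\rangle)=\operatorname{rank}_{\mathbb R}\{H_1|\psi\rangle,\dots,H_d|\psi\rangle\}=\operatorname{rank}\big(\operatorname{Re}\langle H_I\psi|H_J\psi\rangle\big)_{I,J}.$$ 2. The orbit $\operatorname{Orb}_G(\rho)=\{U\rho U^\dagger : U\in G\}$, with the trace-norm topology, is a smooth embedded submanifold of $\operatorname{End}(\mathcal H_m^{\le N})$ (regarded as a real vector space), of dimension $$\dim\operatorname{Orb}_G(\rho)=\operatorname{rank}_{\mathbb R}\{[H_1,\rho],\dots,[H_d,\rho]\}=\operatorname{rank}\big(\operatorname{Tr}([H_I,\rho]^\dagger[H_J,\rho])\big)_{I,J}.$$ Here $\operatorname{rank}_{\mathbb R}$ of a list of vectors is the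 dimension of its real linear span. -/

import Mathlib

open scoped Manifold ContDiff InnerProductSpace

noncomputable section

namespace QuantumOptics

/-! ### Canonical operators on `m` modes -/

/-- Occupation numbers `(n_1, …, n_m)` of `m` modes. -/
abbrev Occ (m : ℕ) : Type := Fin m → ℕ

/-- Finite complex linear combinations of the Fock basis vectors `|n_1, …, n_m⟩`; the vector
`|n⟩` is `Finsupp.single n 1`. All energy-cutoff states lie in this dense part of Fock space. -/
abbrev FiniteFock (m : ℕ) : Type := Occ m →₀ ℂ

/-- The annihilation operator `a_k |n⟩ = √(n_k) |…, n_k - 1, …⟩`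
(the zero vector if `n_k = 0`, as then the coefficient vanishes). -/
def annihilation {m : ℕ} (k : Fin m) : Module.End ℂ (FiniteFock m) :=
  Finsupp.linearCombination ℂ fun n : Occ m =>
    Finsupp.single (Function.update n k (n k - 1)) ((√(n k : ℝ) : ℝ) : ℂ)

/-- The creation operator `a†_k |n⟩ = √(n_k + 1) |…, n_k + 1, …⟩`. -/
def creation {m : ℕ} (k : Fin m) : Module.End ℂ (FiniteFock m) :=
  Finsupp.linearCombination ℂ fun n : Occ m =>
    Finsupp.single (Function.update n k (n k + 1)) ((√((n k : ℝ) + 1) : ℝ) : ℂ)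

/-! ### Passive linear optics -/

/-- Labels of the Hamiltonians of passive linear optics:
`e k l` and `E k l` for `k < l` (beam splitters) and `N k` (phase shifters). -/
inductive PLOIndex (m : ℕ) : Type
  | e (k l : Fin m) (h : k < l) : PLOIndex m
  | E (k l : Fin m) (h : k < l) : PLOIndex m
  | N (k : Fin m) : PLOIndex m

/-- The labels are two copies of the pairs `k < l` and one copy of the modes. -/
def PLOIndex.equivSum (m : ℕ) :
    PLOIndex m ≃ ({p : Fin m × Fin m // p.1 < p.2} ⊕ {p : Fin m × Fin m // p.1 < p.2}) ⊕ Fin m where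
  toFun
    | .e k l h => .inl (.inl ⟨(k, l), h⟩)
    | .E k l h => .inl (.inr ⟨(k, l), h⟩)
    | .N k => .inr k
  invFun
    | .inl (.inl p) => .e p.1.1 p.1.2 p.2
    | .inl (.inr p) => .E p.1.1 p.1.2 p.2
    | .inr k => .N k
  left_inv := by rintro (_ | _ | _) <;> rfl
  right_inv := by rintro ((_ | _) | _) <;> rfl

instance (m : ℕ) : Fintype (PLOIndex m) := Fintype.ofEquiv _ (PLOIndex.equivSum m).symm

/-- The Hamiltonians `e_kl = (a†_k a_l + a†_l a_k) / 2`, `E_kl = i (a†_k a_l - a†_l a_k) / 2`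
and `N_k = a†_k a_k`. -/
def hamiltonian {m : ℕ} : PLOIndex m → Module.End ℂ (FiniteFock m)
  | .e k l _ => (1 / 2 : ℂ) • (creation k * annihilation l + creation l * annihilation k)
  | .E k l _ => (Complex.I / 2) • (creation k * annihilation l - creation l * annihilation k)
  | .N k => creation k * annihilation k

/-! ### The space of states with at most `N` photons -/

/-- Occupation numbers of total photon number at most `N`. -/
abbrev CutoffOcc (m N : ℕ) : Type := {n : Occ m // ∑ k, n k ≤ N}

instance (m N : ℕ) : Finite (CutoffOcc m N) :=
  Finite.of_injective
    (fun (n : CutoffOcc m N) (k : Fin m) =>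
      (⟨n.1 k, Nat.lt_succ_of_le
        ((Finset.single_le_sum (fun _ _ => Nat.zero_le _) (Finset.mem_univ k)).trans n.2)⟩ :
          Fin (N + 1)))
    (fun _ _ h => Subtype.ext (funext fun k => congrArg Fin.val (congrFun h k)))

instance (m N : ℕ) : Fintype (CutoffOcc m N) := Fintype.ofFinite _

/-- The Hilbert space spanned by the Fock basis vectors of total photon number at most `N`, with
these vectors as orthonormal basis. -/
abbrev CutoffSpace (m N : ℕ) : Type := EuclideanSpace ℂ (CutoffOcc m N)

/-- The linear operators on the cutoff space. -/
abbrev CutoffOp (m N : ℕ) : Type := CutoffSpace m N →L[ℂ] CutoffSpace m N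

/-- The inclusion of the cutoff space into Fock space. -/
def toFock (m N : ℕ) : CutoffSpace m N →ₗ[ℂ] FiniteFock m where
  toFun ψ := ∑ n : CutoffOcc m N, Finsupp.single n.1 (ψ n)
  map_add' φ ψ := by simp [Finsupp.single_add, Finset.sum_add_distrib]
  map_smul' c ψ := by simp [Finset.smul_sum]

/-- The Hamiltonian on the cutoff space with the matrix elements `⟨n| H_I |n'⟩`. It is the
restriction of `H_I`, see `toFock_cutoffHamiltonian`. -/
def cutoffHamiltonian {m N : ℕ} (I : PLOIndex m) : CutoffOp m N :=
  Matrix.toEuclideanCLM (n := CutoffOcc m N) (𝕜 := ℂ)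
    (Matrix.of fun n n' => hamiltonian I (Finsupp.single n'.1 1) n.1)

lemma creation_annihilation_apply {m : ℕ} (k l : Fin m) (n n' : Occ m)
    (h : ∑ j, n' j ≠ ∑ j, n j) :
    (creation k * annihilation l : Module.End ℂ (FiniteFock m)) (Finsupp.single n 1) n' = 0 := by
  simp only [Module.End.mul_apply, annihilation, creation, Finsupp.linearCombination_single,
    one_smul, Finsupp.smul_apply, smul_eq_mul, Finsupp.single_apply]
  split_ifs with h1
  · rcases Nat.eq_zero_or_pos (n l) with h0 | h0
    · simp [h0]
    · exfalso
      apply h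
      rw [← h1, Finset.sum_update_of_mem (Finset.mem_univ k)]
      have e1 : ∑ j, Function.update n l (n l - 1) j + 1 = ∑ j, n j := by
        rw [Finset.sum_update_of_mem (Finset.mem_univ l),
          ← Finset.sum_sdiff (Finset.subset_univ {l})]
        simp only [Finset.sum_singleton]
        omega
      rw [← e1, ← Finset.sum_sdiff (Finset.subset_univ {k})]
      simp only [Finset.sum_singleton]
      omega
  · simp

lemma hamiltonian_apply_of_ne {m : ℕ} (I : PLOIndex m) (n n' : Occ m)
    (h : ∑ j, n' j ≠ ∑ j, n j) : hamiltonian I (Finsupp.single n 1) n' = 0 := by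
  cases I <;>
    simp only [hamiltonian, LinearMap.smul_apply, LinearMap.add_apply, LinearMap.sub_apply,
      Finsupp.smul_apply, Finsupp.add_apply, Finsupp.sub_apply,
      creation_annihilation_apply _ _ n n' h, add_zero, sub_zero, smul_zero]

/-- The Hamiltonians of passive linear optics stabilize the cutoff space, and
`cutoffHamiltonian` is their restriction to it. -/
lemma toFock_cutoffHamiltonian {m N : ℕ} (I : PLOIndex m) (ψ : CutoffSpace m N) :
    toFock m N (cutoffHamiltonian I ψ) = hamiltonian I (toFock m N ψ) := by
  have hs : ∀ (n : CutoffOcc m N) (c : ℂ),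
      (Finsupp.single n.1 c : FiniteFock m) = c • Finsupp.single n.1 1 := by simp
  ext n'
  have hr : hamiltonian I (toFock m N ψ) n'
      = ∑ n : CutoffOcc m N, ψ n * hamiltonian I (Finsupp.single n.1 1) n' := by
    simp only [toFock, LinearMap.coe_mk, AddHom.coe_mk, map_sum, Finsupp.finsetSum_apply]
    refine Finset.sum_congr rfl fun n _ => ?_
    rw [hs, map_smul, Finsupp.smul_apply, smul_eq_mul]
  rw [hr]
  simp only [toFock, LinearMap.coe_mk, AddHom.coe_mk, Finsupp.finsetSum_apply,
    Finsupp.single_apply]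
  by_cases hn : ∑ k, n' k ≤ N
  · rw [Finset.sum_eq_single (⟨n', hn⟩ : CutoffOcc m N)]
    · simp [cutoffHamiltonian, Matrix.ofLp_toEuclideanCLM, Matrix.mulVec, dotProduct, mul_comm]
    · intro b _ hb
      rw [if_neg]
      exact fun h => hb (Subtype.ext h)
    · simp
  · rw [Finset.sum_eq_zero, Finset.sum_eq_zero]
    · intro n _
      rw [hamiltonian_apply_of_ne, mul_zero]
      have := n.2
      omega
    · intro n _
      rw [if_neg]
      rintro rfl
      exact hn n.2

/-! ### The group, its orbits, and their dimensions -/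

/-- The unitary `exp(-i t H_I)`. -/
def evolution {m N : ℕ} (I : PLOIndex m) (t : ℝ) : CutoffOp m N :=
  NormedSpace.exp ((-(Complex.I * (t : ℂ))) • (cutoffHamiltonian I : CutoffOp m N))

/-- The group of passive linear optics on the cutoff space: all finite products
`exp(-i t_1 H_1) ⋯ exp(-i t_a H_a)` with Hamiltonians `e_kl`, `E_kl`, `N_k`. -/
def ploGroup (m N : ℕ) : Set (CutoffOp m N) :=
  {U | ∃ L : List (PLOIndex m × ℝ), U = (L.map fun p => evolution p.1 p.2).prod}

/-- The orbit `{U|ψ⟩ : U ∈ G}`. -/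
def ketOrbit {m N : ℕ} (ψ : CutoffSpace m N) : Set (CutoffSpace m N) :=
  {φ | ∃ U ∈ ploGroup m N, φ = U ψ}

/-- The orbit `{U ρ U† : U ∈ G}`. -/
def operatorOrbit {m N : ℕ} (ρ : CutoffOp m N) : Set (CutoffOp m N) :=
  {σ | ∃ U ∈ ploGroup m N, σ = U * ρ * star U}

/-- The trace of an operator. -/
def tr {m N : ℕ} (A : CutoffOp m N) : ℂ := LinearMap.trace ℂ (CutoffSpace m N) A.toLinearMap

/-- Density operators: non-negative operators of trace one. -/
def IsDensityOperator {m N : ℕ} (ρ : CutoffOp m N) : Prop := ρ.IsPositive ∧ tr ρ = 1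

/-- The trace norm `Tr |A|` with `|A| = √(A† A)`. -/
def traceNorm {m N : ℕ} (A : CutoffOp m N) : ℝ := (tr (CFC.abs A)).re

lemma norm_le_traceNorm_le {m N : ℕ} (A : CutoffOp m N) :
    ‖A‖ ≤ traceNorm A ∧
      traceNorm A ≤ Module.finrank ℂ (CutoffSpace m N) * ‖A‖ := by
  have hP : (CFC.abs A).IsPositive :=
    (ContinuousLinearMap.nonneg_iff_isPositive _).1 (CFC.abs_nonneg A)
  have hn : ‖CFC.abs A‖ = ‖A‖ := CFC.norm_abs
  rw [traceNorm, ← hn]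
  generalize CFC.abs A = P at hP
  have hs : P.toLinearMap.IsSymmetric := hP.isSymmetric
  set lam := hs.eigenvalues rfl with hlam
  set b := hs.eigenvectorBasis rfl with hb
  have hPb : ∀ i, P (b i) = (lam i : ℂ) • b i := fun i => hs.apply_eigenvectorBasis rfl i
  have h0 : ∀ i, 0 ≤ lam i := fun i => hP.toLinearMap.nonneg_eigenvalues rfl i
  have htr : (tr P).re = ∑ i, lam i := by
    rw [tr, hs.trace_eq_sum_eigenvalues rfl]
    simp [hlam]
  have hle : ∀ i, lam i ≤ ‖P‖ := fun i => by
    have h := P.le_opNorm (b i)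
    rw [hPb, norm_smul, b.norm_eq_one, mul_one, mul_one, Complex.norm_real] at h
    exact (le_abs_self _).trans h
  rw [htr]
  constructor
  · refine P.opNorm_le_bound (Finset.sum_nonneg fun i _ => h0 i) fun x => ?_
    conv_lhs => rw [← b.sum_repr' x]
    rw [map_sum, Finset.sum_mul]
    refine (norm_sum_le _ _).trans (Finset.sum_le_sum fun i _ => ?_)
    rw [map_smul, hPb, norm_smul, norm_smul, b.norm_eq_one, mul_one, Complex.norm_real,
      Real.norm_of_nonneg (h0 i), mul_comm]
    refine mul_le_mul_of_nonneg_left ?_ (h0 i)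
    simpa [b.norm_eq_one] using norm_inner_le_norm (𝕜 := ℂ) (b i) x
  · simpa using Finset.sum_le_sum fun i (_ : i ∈ Finset.univ) => hle i

/-- The topology of the space of operators is the one of the trace norm. -/
lemma isOpen_iff_traceNorm {m N : ℕ} (s : Set (CutoffOp m N)) :
    IsOpen s ↔ ∀ A ∈ s, ∃ ε > 0, ∀ B, traceNorm (B - A) < ε → B ∈ s := by
  rw [Metric.isOpen_iff]
  refine forall₂_congr fun A _ => ⟨?_, ?_⟩
  · rintro ⟨ε, hε, h⟩
    exact ⟨ε, hε, fun B hB => h (by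
      rw [Metric.mem_ball, dist_eq_norm]
      exact (norm_le_traceNorm_le _).1.trans_lt hB)⟩
  · rintro ⟨ε, hε, h⟩
    set d : ℝ := (Module.finrank ℂ (CutoffSpace m N) : ℝ) with hd
    have hd0 : 0 ≤ d := Nat.cast_nonneg _
    refine ⟨ε / (d + 1), by positivity, fun B hB => h B ?_⟩
    rw [Metric.mem_ball, dist_eq_norm, lt_div_iff₀ (by positivity)] at hB
    have h2 := (norm_le_traceNorm_le (B - A)).2
    nlinarith [norm_nonneg (B - A)]

/-- The subset `S` of the real normed space `V`, with the subspace topology, is a smooth embedded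
submanifold of dimension `r`: it has a smooth structure modelled on `ℝ^r` for which the inclusion
into `V` is a smooth immersion (and a topological embedding). -/
def IsEmbeddedSubmanifold {V : Type*} [NormedAddCommGroup V] [NormedSpace ℝ V]
    (S : Set V) (r : ℕ) : Prop :=
  ∃ _ : ChartedSpace (EuclideanSpace ℝ (Fin r)) S,
    IsManifold (𝓡 r) ∞ S ∧ Manifold.IsSmoothEmbedding (𝓡 r) 𝓘(ℝ, V) ∞ (Subtype.val : S → V)

/-- The rank over `ℝ` of the vectors `H_I |ψ⟩`. -/
def ketRank {m N : ℕ} (ψ : CutoffSpace m N) : ℕ :=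
  Set.finrank ℝ (Set.range fun I : PLOIndex m => (cutoffHamiltonian I : CutoffOp m N) ψ)

/-- The rank over `ℝ` of the commutators `[H_I, ρ]`. -/
def operatorRank {m N : ℕ} (ρ : CutoffOp m N) : ℕ :=
  Set.finrank ℝ (Set.range fun I : PLOIndex m => ⁅(cutoffHamiltonian I : CutoffOp m N), ρ⁆)

/-- The Gram matrix `Re ⟨H_I ψ | H_J ψ⟩`. -/
def ketGram {m N : ℕ} (ψ : CutoffSpace m N) : Matrix (PLOIndex m) (PLOIndex m) ℝ :=
  Matrix.of fun I J =>
    (⟪(cutoffHamiltonian I : CutoffOp m N) ψ, (cutoffHamiltonian J : CutoffOp m N) ψ⟫_ℂ).re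

/-- The Hilbert-Schmidt inner product `Tr (A† B)`. -/
def hsInner {m N : ℕ} (A B : CutoffOp m N) : ℂ := tr (star A * B)

/-- The Gram matrix `⟨[H_I, ρ], [H_J, ρ]⟩` for the Hilbert-Schmidt inner product. For self-adjoint
`ρ` these numbers are real. -/
def operatorGram {m N : ℕ} (ρ : CutoffOp m N) : Matrix (PLOIndex m) (PLOIndex m) ℝ :=
  Matrix.of fun I J =>
    (hsInner ⁅(cutoffHamiltonian I : CutoffOp m N), ρ⁆ ⁅(cutoffHamiltonian J : CutoffOp m N), ρ⁆).re

end QuantumOptics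

end

open Topology

noncomputable section

namespace QuantumOptics

/-! The group on the cutoff space is the image, under second quantization, of a compact group of
unitary `m × m` matrices, and orbits of compact groups under smooth linear representations are
embedded submanifolds.

The compact group appears in the Bargmann picture, where `|n⟩` becomes the polynomial `x^n / √(n!)`,
creation is multiplication by `X k` and annihilation is `pderiv k`. There `-i H_I` is the derivation
attached to the skew-adjoint matrix `generator I`, hence the infinitesimal form of a linear
substitution of variables. So `exp(-i t H_I)` is the substitution by `exp (t • generator I)`
(`evolution_eq_rep`, `ploGroup_eq_image`). The generators span all skew-adjoint matrices over `ℝ`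
(`mem_span_generator`), so their exponential products fill a neighbourhood of `1` among the
unitaries. A subgroup with this property is closed, hence compact (`isCompact_expProducts`).

For the orbit of `v` (`isEmbeddedSubmanifold_orbit`), consider the infinitesimal action `x ↦ R' x
v`. Its range is the tangent space and its kernel exponentiates into the stabilizer. A unitary near
`1` factors as `exp (J a) * exp Y` with `Y` in the kernel and `J` parametrizing a complement, so `a
↦ R (exp (J a)) v` parametrizes the orbit near `v`. Compactness prevents the orbit from returning
close to `v` by group elements far from the stabilizer, which makes the submanifold embedded and not
just immersed. The inverse function theorem then gives a slice chart at `v`, and the group carries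
it to the other points.

The dimension is the rank of the vectors `R' (X i) v`. These are `-i H_I ψ` or `-i [H_I, ρ]`, and
the factor `-i` does not change the real rank. The Gram matrix has this rank because the real inner
product is definite. -/

/-- A chart of a vector space, smooth in both directions, in which the set `S` becomes the slice
`E × {0}`. -/
structure IsSliceChart {V E C : Type*} [NormedAddCommGroup V] [NormedSpace ℝ V]
    [NormedAddCommGroup E] [NormedSpace ℝ E] [NormedAddCommGroup C] [NormedSpace ℝ C]
    (S : Set V) (e : OpenPartialHomeomorph V (E × C)) : Prop where
  contDiffOn : ContDiffOn ℝ ∞ e e.source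
  contDiffOn_symm : ContDiffOn ℝ ∞ e.symm e.target
  mem_iff : ∀ x ∈ e.source, x ∈ S ↔ (e x).2 = 0

/-! ### Slice charts and embedded submanifolds. -/

section SliceChart

variable {V E C : Type*} [NormedAddCommGroup V] [NormedSpace ℝ V]
    [NormedAddCommGroup E] [NormedSpace ℝ E] [NormedAddCommGroup C] [NormedSpace ℝ C]
    {S : Set V}

lemma IsSliceChart.symm_mem {e : OpenPartialHomeomorph V (E × C)} (he : IsSliceChart S e) {a : E}
    (ha : (a, (0 : C)) ∈ e.target) : e.symm (a, 0) ∈ S := by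
  rw [he.mem_iff _ (e.map_target ha), e.right_inv ha]

open Classical in
/-- The chart of `S` induced by a slice chart. -/
def IsSliceChart.chart {e : OpenPartialHomeomorph V (E × C)}
    (he : IsSliceChart S e) (x₀ : S) : OpenPartialHomeomorph S E where
  toFun x := (e x).1
  -- The condition holds throughout the target; `x₀` only serves as a default value outside it.
  invFun a := if h : e.symm (a, 0) ∈ S then ⟨e.symm (a, 0), h⟩ else x₀
  source := Subtype.val ⁻¹' e.source
  target := (fun a => (a, (0 : C))) ⁻¹' e.target
  map_source' x hx := by
    have h0 : (e x).2 = 0 := (he.mem_iff _ hx).1 x.2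
    have : ((e x).1, (0 : C)) = e x := by rw [← h0]
    rw [Set.mem_preimage, this]
    exact e.map_source hx
  map_target' a ha := by
    rw [Set.mem_preimage, dif_pos (he.symm_mem ha)]
    exact e.map_target ha
  left_inv' x hx := by
    have h0 : (e x).2 = 0 := (he.mem_iff _ hx).1 x.2
    have h1 : ((e x).1, (0 : C)) = e x := by rw [← h0]
    have h2 : e.symm ((e x).1, 0) = x := by rw [h1, e.left_inv hx]
    rw [dif_pos (by rw [h2]; exact x.2)]
    exact Subtype.ext h2
  right_inv' a ha := by
    rw [dif_pos (he.symm_mem ha)]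
    simp only
    rw [e.right_inv ha]
  open_source := e.open_source.preimage continuous_subtype_val
  open_target := e.open_target.preimage (by fun_prop)
  continuousOn_toFun := by
    refine continuous_fst.comp_continuousOn (e.continuousOn.comp ?_ fun x hx => hx)
    fun_prop
  continuousOn_invFun := by
    rw [IsInducing.subtypeVal.continuousOn_iff]
    refine (e.continuousOn_symm.comp (f := fun a : E => (a, (0 : C)))
      (by fun_prop) fun x hx => hx).congr fun a ha => ?_
    simp only [Function.comp]
    rw [dif_pos (he.symm_mem ha)]

lemma IsSliceChart.coe_chart_symm {e : OpenPartialHomeomorph V (E × C)}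
    (he : IsSliceChart S e) (x₀ : S) {a : E} (ha : (a, (0 : C)) ∈ e.target) :
    (((he.chart x₀).symm a : S) : V) = e.symm (a, 0) := by
  exact congrArg Subtype.val (dif_pos (he.symm_mem ha))

/-- A set with a slice chart at each of its points is an embedded submanifold. -/
theorem isEmbeddedSubmanifold_of_isSliceChart {r : ℕ}
    (L : (EuclideanSpace ℝ (Fin r) × C) ≃L[ℝ] V)
    (h : ∀ x ∈ S, ∃ e : OpenPartialHomeomorph V (EuclideanSpace ℝ (Fin r) × C),
      IsSliceChart S e ∧ x ∈ e.source) :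
    IsEmbeddedSubmanifold S r := by
  choose e he hxe using fun x : S => h x x.2
  let c : ChartedSpace (EuclideanSpace ℝ (Fin r)) S :=
    { atlas := Set.range fun x : S => (he x).chart x
      chartAt := fun x => (he x).chart x
      mem_chart_source := fun x => hxe x
      chart_mem_atlas := fun x => ⟨x, rfl⟩ }
  have hM : IsManifold (𝓡 r) ∞ S := by
    refine isManifold_of_contDiffOn _ _ _ ?_
    rintro _ _ ⟨x, rfl⟩ ⟨y, rfl⟩
    have h1 : ContDiffOn ℝ ∞ (fun a => (e y (e x |>.symm (a, 0))).1)
        {a | (a, 0) ∈ (e x).target ∧ (e x).symm (a, 0) ∈ (e y).source} := by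
      refine contDiff_fst.comp_contDiffOn ?_
      refine (he y).contDiffOn.comp ((he x).contDiffOn_symm.comp
        (f := fun a => (a, (0 : C))) (by fun_prop) fun a ha => ha.1) fun a ha => ha.2
    refine (h1.mono ?_).congr ?_
    · rintro a ⟨⟨ha1, ha2⟩, -⟩
      refine ⟨ha1, ?_⟩
      have := (he x).coe_chart_symm (a := a) x ha1
      change (e x).symm (a, 0) ∈ (e y).source
      rw [← this]
      exact ha2
    · rintro a ⟨⟨ha1, ha2⟩, -⟩
      have := (he x).coe_chart_symm (a := a) x ha1
      change (e y ((((he x).chart x).symm a : S) : V)).1 = _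
      rw [this]
  refine ⟨c, hM, ?_, IsEmbedding.subtypeVal⟩
  -- The slice chart is followed by `L` so that it takes values in the model space `V`. In these
  -- charts the inclusion reads `a ↦ L (a, 0)`, the normal form of an immersion.
  refine Manifold.IsImmersionOfComplement.isImmersion (F := C) fun x => ?_
  refine Manifold.IsImmersionAtOfComplement.mk_of_charts L ((he x).chart x)
    ((e x).trans L.toHomeomorph.toOpenPartialHomeomorph) (hxe x) (by simpa using hxe x)
    (IsManifold.chart_mem_maximalAtlas (I := 𝓡 r) (n := ∞) x) ?_ ?_ ?_
  · refine OpenPartialHomeomorph.mem_maximalAtlas_of_contMDiffOn _ ?_ ?_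
    · refine ContDiffOn.contMDiffOn ?_
      have := L.contDiff.comp_contDiffOn ((he x).contDiffOn)
      refine (this.mono ?_)
      intro y hy
      simpa using hy
    · refine ContDiffOn.contMDiffOn ?_
      have := (he x).contDiffOn_symm.comp (L.symm.contDiff.contDiffOn (s := L.symm ⁻¹' (e x).target))
        (fun a ha => ha)
      refine (this.mono ?_)
      intro y hy
      simpa using hy
  · intro y hy
    have hy' : (y : V) ∈ (e x).source := hy
    simpa using hy'
  · intro a ha
    have ha' : (a, (0 : C)) ∈ (e x).target := by
      have h2 : a ∈ ((he x).chart x).target := by simpa using ha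
      exact h2
    have := (he x).coe_chart_symm x ha'
    simp [this, (e x).right_inv ha']

end SliceChart

/-! ### Exponential products of skew-adjoint elements form a compact group. -/

section CStar

variable {A : Type*} [CStarAlgebra A]

/-- Since `exp S` is also self-adjoint, unitarity gives `exp (S + S) = 1`, and the logarithm inverts
`exp` on self-adjoint elements. -/
lemma isSelfAdjoint_eq_zero_of_exp_mem_unitary {S : A} (hS : IsSelfAdjoint S)
    (h : NormedSpace.exp S ∈ unitary A) : S = 0 := by
  let _ : NormedAlgebra ℚ A := NormedAlgebra.restrictScalars ℚ ℝ A
  have h1 : NormedSpace.exp (S + S) = 1 := by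
    rw [NormedSpace.exp_add_of_commute (Commute.refl S)]
    have := Unitary.star_mul_self_of_mem h
    rwa [hS.exp.star_eq] at this
  have h2 := CFC.log_exp (S + S) (hS.add hS)
  rw [h1, CFC.log_one] at h2
  have h3 : (2 : ℝ) • S = 0 := by rw [two_smul]; exact h2.symm
  simpa using h3

/-- A map into the unitary group whose derivative at a point over `1` hits all skew-adjoint
elements is locally onto the unitary group. -/
lemma eventually_mem_unitary_imp_mem_image {E : Type*} [NormedAddCommGroup E] [NormedSpace ℝ E]
    [CompleteSpace E] {g : E → A} {g' : E →L[ℝ] A} (hg : HasStrictFDerivAt g g' 0)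
    (hg0 : g 0 = 1) (hgu : ∀ e, g e ∈ unitary A) (hsurj : ∀ x ∈ skewAdjoint A, ∃ e, g' e = x)
    {s : Set E} (hs : s ∈ 𝓝 0) : ∀ᶠ u in 𝓝 (1 : A), u ∈ unitary A → u ∈ g '' s := by
  -- A factor `exp S` with `S` self-adjoint, as in the polar decomposition, completes the derivative
  -- to a surjection onto `A`, so that `(e, S) ↦ g e * exp S` is open at the origin. If the product
  -- is unitary, then so is `exp S`, which forces `S = 0`.
  let H := selfAdjoint.submodule ℝ A
  have hcl : IsClosed (H : Set A) := by
    have : (H : Set A) = {x | star x = x} := rfl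
    rw [this]
    exact isClosed_eq continuous_star continuous_id
  have : CompleteSpace H := hcl.completeSpace_coe
  have hexp : HasStrictFDerivAt (NormedSpace.exp : A → A) (1 : A →L[ℝ] A) 0 :=
    hasStrictFDerivAt_exp_zero
  have h1 : HasStrictFDerivAt (fun p : E × H => g p.1) (g'.comp (ContinuousLinearMap.fst ℝ E H))
      (0, 0) :=
    HasStrictFDerivAt.comp (g := g) (0, 0) hg (ContinuousLinearMap.fst ℝ E H).hasStrictFDerivAt
  have h2 : HasStrictFDerivAt (fun p : E × H => NormedSpace.exp (p.2 : A))
      (H.subtypeL.comp (ContinuousLinearMap.snd ℝ E H)) (0, 0) := by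
    refine HasStrictFDerivAt.comp (g := (NormedSpace.exp : A → A))
      (g' := (1 : A →L[ℝ] A)) (0, 0) ?_
      (H.subtypeL.comp (ContinuousLinearMap.snd ℝ E H)).hasStrictFDerivAt
    simpa using hexp
  have h3 := h1.mul' h2
  have hr : (g'.comp (ContinuousLinearMap.fst ℝ E H) +
      H.subtypeL.comp (ContinuousLinearMap.snd ℝ E H)).range = ⊤ := by
    rw [LinearMap.range_eq_top]
    intro x
    obtain ⟨e, he⟩ := hsurj (skewAdjointPart ℝ x) (skewAdjointPart ℝ x).2
    refine ⟨(e, ⟨selfAdjointPart ℝ x, (selfAdjointPart ℝ x).2⟩), ?_⟩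
    have := StarModule.selfAdjointPart_add_skewAdjointPart ℝ x
    simp only [ContinuousLinearMap.coe_coe, _root_.add_apply,
      ContinuousLinearMap.comp_apply, ContinuousLinearMap.coe_fst', he,
      ContinuousLinearMap.coe_snd', Submodule.subtypeL_apply]
    rw [add_comm]
    exact this
  have h4 := HasStrictFDerivAt.map_nhds_eq_of_surj
    (f' := g'.comp (ContinuousLinearMap.fst ℝ E H) +
      H.subtypeL.comp (ContinuousLinearMap.snd ℝ E H)) (h3.congr_fderiv (by ext <;> simp [hg0])) hr
  have h5 : g 0 * NormedSpace.exp ((0 : H) : A) = 1 := by simp [hg0]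
  change _ = 𝓝 (g 0 * NormedSpace.exp ((0 : H) : A)) at h4
  rw [h5] at h4
  have h6 : (fun p : E × H => g p.1 * NormedSpace.exp (p.2 : A)) '' (s ×ˢ Set.univ) ∈ 𝓝 (1 : A) := by
    rw [← h4]
    refine Filter.image_mem_map ?_
    exact prod_mem_nhds hs Filter.univ_mem
  filter_upwards [h6] with u hu huu
  obtain ⟨⟨e, S⟩, ⟨he, -⟩, rfl⟩ := hu
  refine ⟨e, he, ?_⟩
  have h7 : NormedSpace.exp (S : A) ∈ unitary A := by
    have := mul_mem (Unitary.star_mem (hgu e)) huu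
    simpa [← mul_assoc, Unitary.star_mul_self_of_mem (hgu e)] using this
  have h8 : (S : A) = 0 := isSelfAdjoint_eq_zero_of_exp_mem_unitary S.2 h7
  simp [h8]

lemma exp_smul_mem_unitary {x : A} (hx : x ∈ skewAdjoint A) (t : ℝ) :
    NormedSpace.exp (t • x) ∈ unitary A := by
  let _ : NormedAlgebra ℚ A := NormedAlgebra.restrictScalars ℚ ℝ A
  exact NormedSpace.exp_mem_unitary_of_mem_skewAdjoint (skewAdjoint.smul_mem t hx)

variable {ι : Type*}

/-- The products `exp (t₁ X₁) ⋯ exp (tₐ Xₐ)`. -/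
def expProducts (X : ι → A) : Set A :=
  {u | ∃ L : List (ι × ℝ), u = (L.map fun p => NormedSpace.exp (p.2 • X p.1)).prod}

lemma one_mem_expProducts (X : ι → A) : 1 ∈ expProducts X := ⟨[], by simp⟩

lemma mul_mem_expProducts {X : ι → A} {u v : A} (hu : u ∈ expProducts X)
    (hv : v ∈ expProducts X) : u * v ∈ expProducts X := by
  obtain ⟨L, rfl⟩ := hu
  obtain ⟨L', rfl⟩ := hv
  exact ⟨L ++ L', by simp⟩

lemma expProducts_subset_unitary {X : ι → A} (hX : ∀ i, X i ∈ skewAdjoint A) :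
    expProducts X ⊆ unitary A := by
  rintro _ ⟨L, rfl⟩
  refine list_prod_mem fun u hu => ?_
  obtain ⟨p, -, rfl⟩ := List.mem_map.1 hu
  exact exp_smul_mem_unitary (hX _) _

lemma star_mem_expProducts {X : ι → A} (hX : ∀ i, X i ∈ skewAdjoint A) {u : A}
    (hu : u ∈ expProducts X) : star u ∈ expProducts X := by
  obtain ⟨L, rfl⟩ := hu
  induction L with
  | nil => simpa using one_mem_expProducts X
  | cons p L ih =>
    rw [List.map_cons, List.prod_cons, star_mul]
    refine mul_mem_expProducts ih ⟨[(p.1, -p.2)], ?_⟩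
    simp [NormedSpace.star_exp, skewAdjoint.mem_iff.1 (hX _)]

/-- All factors equal `1` at `0`, so the product rule leaves the sum `∑ tᵢ Xᵢ`. -/
lemma hasStrictFDerivAt_list_prod_exp [Fintype ι] (X : ι → A) (l : List ι) :
    HasStrictFDerivAt (fun t : ι → ℝ => (l.map fun i => NormedSpace.exp (t i • X i)).prod)
      ((l.map fun i => (ContinuousLinearMap.proj (R := ℝ) (φ := fun _ : ι => ℝ) i).smulRight
        (X i)).sum) 0 := by
  induction l with
  | nil => simpa using hasStrictFDerivAt_const (1 : A) (0 : ι → ℝ)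
  | cons i l ih =>
    simp only [List.map_cons, List.prod_cons, List.sum_cons]
    have h1 : HasStrictFDerivAt (fun t : ι → ℝ => NormedSpace.exp (t i • X i))
        ((ContinuousLinearMap.proj (R := ℝ) (φ := fun _ : ι => ℝ) i).smulRight (X i)) 0 := by
      refine HasStrictFDerivAt.comp (g := (NormedSpace.exp : A → A))
        (g' := (1 : A →L[ℝ] A)) (0 : ι → ℝ) ?_
        ((ContinuousLinearMap.proj (R := ℝ) (φ := fun _ : ι => ℝ) i).smulRight
          (X i)).hasStrictFDerivAt
      simpa using hasStrictFDerivAt_exp_zero (𝕂 := ℝ) (𝔸 := A)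
    refine (h1.mul' ih).congr_fderiv ?_
    ext t
    simp [add_comm]

/-- Because the `Xᵢ` span as they stand, without taking brackets, a product with one exponential per
index already covers a neighbourhood of `1`. -/
lemma eventually_mem_unitary_imp_mem_expProducts [Fintype ι] {X : ι → A}
    (hX : ∀ i, X i ∈ skewAdjoint A)
    (hspan : ∀ x ∈ skewAdjoint A, x ∈ Submodule.span ℝ (Set.range X)) :
    ∀ᶠ u in 𝓝 (1 : A), u ∈ unitary A → u ∈ expProducts X := by
  have h := eventually_mem_unitary_imp_mem_image
    (hasStrictFDerivAt_list_prod_exp X (Finset.univ.toList)) (by simp) (fun t => ?_) ?_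
    (Filter.univ_mem)
  · filter_upwards [h] with u hu huu
    obtain ⟨t, -, rfl⟩ := hu huu
    refine ⟨Finset.univ.toList.map fun i => (i, t i), ?_⟩
    simp [Function.comp_def]
  · refine list_prod_mem fun u hu => ?_
    obtain ⟨p, -, rfl⟩ := List.mem_map.1 hu
    exact exp_smul_mem_unitary (hX _) _
  · intro x hx
    obtain ⟨c, hc⟩ := (Submodule.mem_span_range_iff_exists_fun ℝ).1 (hspan x hx)
    refine ⟨c, ?_⟩
    have h0 : ∀ l : List ι, ((l.map fun i => (ContinuousLinearMap.proj (R := ℝ)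
        (φ := fun _ : ι => ℝ) i).smulRight (X i)).sum) c = (l.map fun i => c i • X i).sum := by
      intro l
      induction l with
      | nil => simp
      | cons i l ih => simp [ih]
    rw [← hc, h0, Finset.sum_map_toList]

/-- For `u` in the closure and a product `k` close to `u`, the unitary `star u * k` is close to `1`,
hence itself a product. Then so is `u = k * star (star u * k)`. -/
lemma isClosed_expProducts [Fintype ι] {X : ι → A}
    (hX : ∀ i, X i ∈ skewAdjoint A)
    (hspan : ∀ x ∈ skewAdjoint A, x ∈ Submodule.span ℝ (Set.range X)) :
    IsClosed (expProducts X) := by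
  refine isClosed_of_closure_subset fun u hu => ?_
  have hU : IsClosed (unitary A : Set A) := isClosed_unitary
  have huu : u ∈ unitary A := closure_minimal (expProducts_subset_unitary hX) hU hu
  have h1 : Filter.Tendsto (fun k : A => star u * k) (𝓝 u) (𝓝 1) := by
    have : Continuous fun k : A => star u * k := by fun_prop
    simpa [Unitary.star_mul_self_of_mem huu] using this.tendsto u
  have h2 := h1.eventually (eventually_mem_unitary_imp_mem_expProducts hX hspan)
  obtain ⟨k, hk, hkK⟩ := mem_closure_iff_nhds.1 hu _ h2
  have h3 := hk (mul_mem (Unitary.star_mem huu) (expProducts_subset_unitary hX hkK))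
  have h4 := mul_mem_expProducts hkK (star_mem_expProducts hX h3)
  rwa [star_mul, star_star, ← mul_assoc,
    Unitary.mul_star_self_of_mem (expProducts_subset_unitary hX hkK), one_mul] at h4

lemma isCompact_expProducts [FiniteDimensional ℝ A] [Fintype ι] {X : ι → A}
    (hX : ∀ i, X i ∈ skewAdjoint A)
    (hspan : ∀ x ∈ skewAdjoint A, x ∈ Submodule.span ℝ (Set.range X)) :
    IsCompact (expProducts X) := by
  have := FiniteDimensional.proper_real A
  refine Metric.isCompact_of_isClosed_isBounded (isClosed_expProducts hX hspan) ?_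
  refine (Metric.isBounded_closedBall (x := (0 : A)) (r := 1)).subset fun u hu => ?_
  rw [mem_closedBall_zero_iff]
  cases subsingleton_or_nontrivial A
  · simp [Subsingleton.elim u 0]
  · exact (CStarRing.norm_of_mem_unitary (expProducts_subset_unitary hX hu)).le

end CStar

/-! ### Multiplicative maps and exponentials. -/

section MonoidHom

variable {A B : Type*} [NormedRing A] [NormedAlgebra ℝ A] [CompleteSpace A]
  [NormedRing B] [NormedAlgebra ℝ B]

/-- The splitting `exp (s • Y) = exp (t • Y) * exp ((s - t) • Y)` reduces the derivative at `t` to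
the one at `0`. -/
lemma hasDerivAt_monoidHom_exp_smul {R : A →* B} {R' : A →L[ℝ] B} (hR : HasFDerivAt R R' 1)
    (Y : A) (t : ℝ) :
    HasDerivAt (fun s : ℝ => R (NormedSpace.exp (s • Y)))
      (R (NormedSpace.exp (t • Y)) * R' Y) t := by
  let _ : NormedAlgebra ℚ A := NormedAlgebra.restrictScalars ℚ ℝ A
  have h0 : HasDerivAt (fun s : ℝ => R (NormedSpace.exp (s • Y))) (R' Y) 0 := by
    have h1 : HasDerivAt (fun s : ℝ => NormedSpace.exp (s • Y)) Y 0 := by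
      simpa using hasDerivAt_exp_smul_const (𝕂 := ℝ) Y (0 : ℝ)
    have h2 : HasFDerivAt R R' (NormedSpace.exp ((0 : ℝ) • Y)) := by simpa using hR
    exact h2.comp_hasDerivAt (0 : ℝ) h1
  have h1 : HasDerivAt (fun s : ℝ => R (NormedSpace.exp ((s - t) • Y))) (R' Y) t := by
    have h2 : HasDerivAt (fun s : ℝ => R (NormedSpace.exp (s • Y))) (R' Y) (t - t) := by
      simpa using h0
    exact h2.comp_sub_const t t
  refine (h1.const_mul (R (NormedSpace.exp (t • Y)))).congr_of_eventuallyEq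
    (Filter.Eventually.of_forall fun s => ?_)
  simp only
  rw [← map_mul, ← NormedSpace.exp_add_of_commute]
  · rw [← add_smul, add_sub_cancel]
  · exact ((Commute.refl Y).smul_left _).smul_right _

/-- Multiplying by `exp (-s • R' Y)` gives a curve with zero derivative, which is therefore
constantly `1`. -/
lemma monoidHom_exp_smul [CompleteSpace B] {R : A →* B} {R' : A →L[ℝ] B}
    (hR : HasFDerivAt R R' 1) (Y : A) (t : ℝ) :
    R (NormedSpace.exp (t • Y)) = NormedSpace.exp (t • R' Y) := by
  let _ : NormedAlgebra ℚ B := NormedAlgebra.restrictScalars ℚ ℝ B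
  have hd : ∀ s : ℝ, HasDerivAt
      (fun s : ℝ => R (NormedSpace.exp (s • Y)) * NormedSpace.exp (s • -R' Y)) 0 s := fun s => by
    have h := (hasDerivAt_monoidHom_exp_smul hR Y s).mul
      (hasDerivAt_exp_smul_const' (𝕂 := ℝ) (-R' Y) s)
    refine h.congr_deriv ?_
    noncomm_ring
  have hc := is_const_of_deriv_eq_zero (fun s => (hd s).differentiableAt)
    (fun s => (hd s).deriv) t 0
  simp only [zero_smul, NormedSpace.exp_zero, map_one, mul_one] at hc
  have h2 : NormedSpace.exp (t • -R' Y) * NormedSpace.exp (t • R' Y) = 1 := by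
    rw [← NormedSpace.exp_add_of_commute]
    · simp
    · exact ((Commute.refl (R' Y)).neg_left.smul_left _).smul_right _
  calc R (NormedSpace.exp (t • Y))
      = R (NormedSpace.exp (t • Y)) *
        (NormedSpace.exp (t • -R' Y) * NormedSpace.exp (t • R' Y)) := by rw [h2, mul_one]
    _ = _ := by rw [← mul_assoc, hc, one_mul]

end MonoidHom

/-! ### Orbits near the base point. -/

section Orbit

variable {A V : Type*} [CStarAlgebra A] [NormedAddCommGroup V] [NormedSpace ℝ V]

/-- The curve `R (exp (s • Y)) v` has derivative `R (exp (s • Y)) (R' Y v) = 0`: infinitesimal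
stabilizers exponentiate to stabilizers. -/
lemma monoidHom_exp_apply_eq_self {R : A →* (V →L[ℝ] V)} {R' : A →L[ℝ] V →L[ℝ] V}
    (hR : HasFDerivAt R R' 1) {Y : A} {v : V} (h : R' Y v = 0) :
    R (NormedSpace.exp Y) v = v := by
  have hd : ∀ s : ℝ, HasDerivAt (fun s : ℝ => R (NormedSpace.exp (s • Y)) v) 0 s := fun s => by
    have h1 := (hasDerivAt_monoidHom_exp_smul hR Y s).clm_apply (hasDerivAt_const s v)
    simpa [h] using h1
  have hc := is_const_of_deriv_eq_zero (fun s => (hd s).differentiableAt)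
    (fun s => (hd s).deriv) 1 0
  simpa using hc

/-- A point of the orbit of a compact group near the base point is moved there by an element
near the identity. -/
lemma eventually_mem_orbit_imp {K : Set A} (hK : IsCompact K)
    (hKu : K ⊆ unitary A) (hmul : ∀ u ∈ K, ∀ v ∈ K, u * v ∈ K) (hstar : ∀ u ∈ K, star u ∈ K)
    {R : A →* (V →L[ℝ] V)} (hR : Continuous R) (v : V) {W : Set A} (hW : W ∈ 𝓝 1) :
    ∀ᶠ w in 𝓝 v, (∃ u ∈ K, w = R u v) → ∃ u ∈ K ∩ W, w = R u v := by
  obtain ⟨W', hW'W, hW'o, hW'1⟩ := mem_nhds_iff.1 hW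
  -- `K'` collects the elements of `K` that are not a `W'`-small multiple of a stabilizer element.
  -- It is compact, so its image is closed, and the image misses `v` because the stabilizer was
  -- removed.
  set K' : Set A := K \ ⋃ h ∈ {h ∈ K | R h v = v}, (fun u => u * star h) ⁻¹' W' with hK'
  have hK'c : IsCompact K' := hK.diff
    (isOpen_biUnion fun h _ => hW'o.preimage (by fun_prop))
  have hcl : IsClosed ((fun u => R u v) '' K') :=
    (hK'c.image (by fun_prop)).isClosed
  have hv : v ∉ (fun u => R u v) '' K' := by
    rintro ⟨g, ⟨hgK, hg⟩, hgv⟩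
    apply hg
    refine Set.mem_biUnion (x := g) ⟨hgK, hgv⟩ ?_
    simpa [Unitary.mul_star_self_of_mem (hKu hgK)] using hW'1
  filter_upwards [hcl.isOpen_compl.mem_nhds hv] with w hw
  rintro ⟨g, hgK, rfl⟩
  have hg : g ∉ K' := fun h => hw ⟨g, h, rfl⟩
  rw [hK', Set.mem_sdiff, not_and, not_not] at hg
  obtain ⟨h, ⟨hhK, hhv⟩, hgh⟩ := Set.mem_iUnion₂.1 (hg hgK)
  refine ⟨g * star h, ⟨hmul _ hgK _ (hstar _ hhK), hW'W hgh⟩, ?_⟩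
  have : R (star h) v = v := by
    have h1 : R (star h * h) v = v := by simp [Unitary.star_mul_self_of_mem (hKu hhK)]
    rwa [map_mul, mul_apply_eq_comp, hhv] at h1
  rw [map_mul, mul_apply_eq_comp, this]

lemma contDiff_exp : ContDiff ℝ ω (NormedSpace.exp : A → A) :=
  contDiff_iff_contDiffAt.2 fun x => (NormedSpace.exp_analytic (𝕂 := ℝ) x).contDiffAt

end Orbit

/-! ### Slice charts of orbits. -/

section OrbitChart

variable {A V : Type*} [CStarAlgebra A] [FiniteDimensional ℝ A]
  [NormedAddCommGroup V] [NormedSpace ℝ V] {ι : Type*} [Fintype ι]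

/-- The chart inverts `F (a, c) = f a + q c`, whose derivative at `0` is `L`. Hypothesis `hSf` says
that points of `S` near `f 0` come from small parameters; injectivity of `F` then puts them in the
slice `c = 0`. -/
lemma exists_isSliceChart_of_localParametrization {E C : Type*} [NormedAddCommGroup E]
    [NormedSpace ℝ E] [NormedAddCommGroup C] [NormedSpace ℝ C] [CompleteSpace E]
    [CompleteSpace C] {S : Set V} {f : E → V} (hf : ContDiff ℝ ω f) {j : E →L[ℝ] V}
    (hf' : HasFDerivAt f j 0) {q : C →L[ℝ] V} {L : (E × C) ≃L[ℝ] V}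
    (hL : ∀ p, L p = j p.1 + q p.2) (hfS : ∀ᶠ a in 𝓝 0, f a ∈ S)
    (hSf : ∀ s ∈ 𝓝 (0 : E), ∀ᶠ w in 𝓝 (f 0), w ∈ S → ∃ a ∈ s, w = f a) :
    ∃ e : OpenPartialHomeomorph V (E × C), IsSliceChart S e ∧ f 0 ∈ e.source := by
  let F : E × C → V := fun p => f p.1 + q p.2
  have hF : ContDiff ℝ ω F := by fun_prop
  have hF' : HasFDerivAt F (L : E × C →L[ℝ] V) 0 := by
    have h1 : HasFDerivAt (fun p : E × C => f p.1) (j.comp (ContinuousLinearMap.fst ℝ E C)) 0 :=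
      HasFDerivAt.comp (g := f) (0 : E × C) hf' (ContinuousLinearMap.fst ℝ E C).hasFDerivAt
    have h2 : HasFDerivAt (fun p : E × C => q p.2) (q.comp (ContinuousLinearMap.snd ℝ E C)) 0 :=
      (q.comp (ContinuousLinearMap.snd ℝ E C)).hasFDerivAt
    refine (h1.add h2).congr_fderiv ?_
    ext p <;> simp [hL]
  have hω : (ω : WithTop ℕ∞) ≠ 0 := by simp
  let e₀ := hF.contDiffAt.toOpenPartialHomeomorph F hF' hω
  have he₀ : (e₀ : E × C → V) = F := rfl
  have h0 : (0 : E × C) ∈ e₀.source := hF.contDiffAt.mem_toOpenPartialHomeomorph_source hF' hω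
  have hF0 : F 0 = f 0 := by simp [F]
  have hinv : ∀ᶠ w in 𝓝 (f 0), ContDiffAt ℝ ω e₀.symm w := by
    rw [← hF0]
    exact (hF.contDiffAt.to_localInverse hF' hω).eventually (by simp)
  have hs : {a : E | (a, (0 : C)) ∈ e₀.source} ∈ 𝓝 (0 : E) :=
    ContinuousAt.preimage_mem_nhds (f := fun a : E => (a, (0 : C))) (by fun_prop)
      (e₀.open_source.mem_nhds h0)
  obtain ⟨W, hW, hWo, hW0⟩ := eventually_nhds_iff.1 (hinv.and (hSf _ hs))
  obtain ⟨s, hs', hso, hs0⟩ := eventually_nhds_iff.1 hfS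
  -- Shrinking to `Ω` secures three things: `f` lands in `S`, the inverse is smooth, and points of
  -- `S` have the form `f a` with `(a, 0)` in the domain of injectivity.
  let Ω : Set (E × C) := Prod.fst ⁻¹' s ∩ F ⁻¹' W
  have hΩ : IsOpen Ω := (hso.preimage continuous_fst).inter (hWo.preimage hF.continuous)
  refine ⟨(e₀.restrOpen Ω hΩ).symm, ⟨?_, ?_, ?_⟩, ?_⟩
  · intro w hw
    obtain ⟨p, ⟨hp, hpΩ⟩, rfl⟩ : ∃ p ∈ (e₀.restrOpen Ω hΩ).source, F p = w :=
      ⟨_, (e₀.restrOpen Ω hΩ).map_target hw, (e₀.restrOpen Ω hΩ).right_inv hw⟩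
    exact ((hW _ hpΩ.2).1.of_le (by simp)).contDiffWithinAt
  · exact (hF.of_le (by simp)).contDiffOn
  · intro w hw
    obtain ⟨p, ⟨hp, hpΩ⟩, rfl⟩ : ∃ p ∈ (e₀.restrOpen Ω hΩ).source, F p = w :=
      ⟨_, (e₀.restrOpen Ω hΩ).map_target hw, (e₀.restrOpen Ω hΩ).right_inv hw⟩
    have hep : (e₀.restrOpen Ω hΩ).symm (F p) = p := e₀.left_inv hp
    rw [hep]
    constructor
    · intro hpS
      obtain ⟨a, ha, hpa⟩ := (hW _ hpΩ.2).2 hpS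
      have h1 : p = (a, 0) := e₀.injOn hp ha (by rw [he₀, hpa]; simp [F])
      rw [h1]
    · intro h2
      have h3 : F p = f p.1 := by simp [F, h2]
      rw [h3]
      exact hs' _ hpΩ.1
  · rw [← hF0]
    exact (e₀.restrOpen Ω hΩ).map_source ⟨h0, hs0, by rw [Set.mem_preimage, hF0]; exact hW0⟩

omit [FiniteDimensional ℝ A] in
lemma hasStrictFDerivAt_exp_comp {E : Type*} [NormedAddCommGroup E] [NormedSpace ℝ E]
    (J : E →L[ℝ] A) : HasStrictFDerivAt (fun a => NormedSpace.exp (J a)) J 0 := by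
  refine HasStrictFDerivAt.comp (g := (NormedSpace.exp : A → A)) (g' := (1 : A →L[ℝ] A))
    (0 : E) ?_ J.hasStrictFDerivAt
  simpa using hasStrictFDerivAt_exp_zero (𝕂 := ℝ) (𝔸 := A)

omit [FiniteDimensional ℝ A] in
lemma hasStrictFDerivAt_exp_mul_exp {E F : Type*} [NormedAddCommGroup E] [NormedSpace ℝ E]
    [NormedAddCommGroup F] [NormedSpace ℝ F] (J : E →L[ℝ] A) (J' : F →L[ℝ] A) :
    HasStrictFDerivAt (fun p : E × F => NormedSpace.exp (J p.1) * NormedSpace.exp (J' p.2))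
      (J.comp (ContinuousLinearMap.fst ℝ E F) + J'.comp (ContinuousLinearMap.snd ℝ E F)) 0 := by
  have h1 := hasStrictFDerivAt_exp_comp (J.comp (ContinuousLinearMap.fst ℝ E F))
  have h2 := hasStrictFDerivAt_exp_comp (J'.comp (ContinuousLinearMap.snd ℝ E F))
  refine (h1.mul' h2).congr_fderiv (ContinuousLinearMap.ext fun p => ?_)
  simp [add_comm]

omit [FiniteDimensional ℝ A] in
lemma eventually_mem_unitary_imp_exists_exp_mul_exp {E F : Type*} [NormedAddCommGroup E]
    [NormedSpace ℝ E] [NormedAddCommGroup F] [NormedSpace ℝ F] [CompleteSpace E] [CompleteSpace F]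
    {J : E →L[ℝ] A} {J' : F →L[ℝ] A} (hJ : ∀ a, J a ∈ skewAdjoint A)
    (hJ' : ∀ b, J' b ∈ skewAdjoint A) (hsurj : ∀ x ∈ skewAdjoint A, ∃ a b, J a + J' b = x)
    {s : Set E} (hs : s ∈ 𝓝 0) :
    ∀ᶠ u in 𝓝 (1 : A), u ∈ unitary A →
      ∃ a ∈ s, ∃ b, u = NormedSpace.exp (J a) * NormedSpace.exp (J' b) := by
  have hs' : Prod.fst ⁻¹' s ∈ 𝓝 (0 : E × F) := continuous_fst.continuousAt.preimage_mem_nhds hs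
  have h := eventually_mem_unitary_imp_mem_image (hasStrictFDerivAt_exp_mul_exp J J') (by simp)
    (fun p => mul_mem (by simpa using exp_smul_mem_unitary (hJ p.1) 1)
      (by simpa using exp_smul_mem_unitary (hJ' p.2) 1))
    (fun x hx => ?_) hs'
  · filter_upwards [h] with u hu huu
    obtain ⟨⟨a, b⟩, ha, rfl⟩ := hu huu
    exact ⟨a, ha, b, rfl⟩
  · obtain ⟨a, b, rfl⟩ := hsurj x hx
    exact ⟨(a, b), rfl⟩

/-- The orbits of the group generated by `exp (t Xᵢ)`, with `Xᵢ` spanning the skew-adjoint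
elements, are embedded submanifolds. -/
theorem isEmbeddedSubmanifold_orbit [FiniteDimensional ℝ V] {X : ι → A} (hX : ∀ i, X i ∈ skewAdjoint A)
    (hspan : ∀ x ∈ skewAdjoint A, x ∈ Submodule.span ℝ (Set.range X))
    {R : A →* (V →L[ℝ] V)} (hR : ContDiff ℝ ω R) {R' : A →L[ℝ] V →L[ℝ] V}
    (hR' : HasFDerivAt R R' 1) (v : V) :
    IsEmbeddedSubmanifold {w | ∃ u ∈ expProducts X, w = R u v}
      (Set.finrank ℝ (Set.range fun i => R' (X i) v)) := by
  let 𝔤 : Submodule ℝ A := Submodule.span ℝ (Set.range X)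
  have h𝔤 : ∀ x ∈ 𝔤, x ∈ skewAdjoint A := fun x hx => by
    have : 𝔤 ≤ skewAdjoint.submodule ℝ A := Submodule.span_le.2 (by rintro _ ⟨i, rfl⟩; exact hX i)
    exact this hx
  let T : 𝔤 →ₗ[ℝ] V := (ContinuousLinearMap.apply ℝ V v ∘L R').toLinearMap.comp 𝔤.subtype
  have hT : ∀ x, T x = R' x v := fun x => rfl
  have hrange : LinearMap.range T = Submodule.span ℝ (Set.range fun i => R' (X i) v) := by
    rw [LinearMap.range_comp, Submodule.range_subtype, Submodule.map_span, ← Set.range_comp]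
    rfl
  obtain ⟨r, hr⟩ : ∃ r, r = Set.finrank ℝ (Set.range fun i => R' (X i) v) := ⟨_, rfl⟩
  have hr' : Module.finrank ℝ (EuclideanSpace ℝ (Fin r)) = Module.finrank ℝ (LinearMap.range T) := by
    rw [finrank_euclideanSpace_fin, hr, hrange]; rfl
  rw [← hr]
  let E := EuclideanSpace ℝ (Fin r)
  let b : E ≃L[ℝ] LinearMap.range T := ContinuousLinearEquiv.ofFinrankEq hr'
  -- A linear section of the infinitesimal action: its image is a complement of the stabilizer
  -- algebra, along which the orbit is parametrized.
  obtain ⟨σ, hσ⟩ := T.rangeRestrict.exists_rightInverse_of_surjective T.range_rangeRestrict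
  let j : E →L[ℝ] 𝔤 := (σ.comp b.toLinearMap).toContinuousLinearMap
  have hj : ∀ a, T (j a) = b a := fun a => congrArg Subtype.val (LinearMap.congr_fun hσ (b a))
  let J : E →L[ℝ] A := 𝔤.subtypeL ∘L j
  obtain ⟨C, hC⟩ := Submodule.exists_isCompl (LinearMap.range T)
  let L : (E × C) ≃L[ℝ] V := ((b.toLinearEquiv.prodCongr (LinearEquiv.refl ℝ C)).trans
    (Submodule.prodEquivOfIsCompl _ _ hC)).toContinuousLinearEquiv
  have hL : ∀ p, L p = (b p.1 : V) + p.2 := fun p => rfl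
  let f : E → V := fun a => R (NormedSpace.exp (J a)) v
  have hf0 : f 0 = v := by simp [f]
  have hfc : ContDiff ℝ ω f := (hR.comp (contDiff_exp.comp J.contDiff)).clm_apply contDiff_const
  have hJexp := hasStrictFDerivAt_exp_comp J
  have hfd : HasFDerivAt f ((LinearMap.range T).subtypeL ∘L b.toContinuousLinearMap) 0 := by
    have h1 : HasFDerivAt R R' (NormedSpace.exp (J 0)) := by simpa using hR'
    have h2 := (HasFDerivAt.comp (0 : E) h1 hJexp.hasFDerivAt).clm_apply
      (hasFDerivAt_const v (0 : E))
    refine h2.congr_fderiv ?_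
    ext a
    have := hj a
    simp only [hT] at this
    simp [J, this]
  have hK := eventually_mem_unitary_imp_mem_expProducts hX hspan
  have hJu : ∀ a, NormedSpace.exp (J a) ∈ unitary A := fun a => by
    simpa [J] using exp_smul_mem_unitary (h𝔤 _ (j a).2) 1
  have hfS : ∀ᶠ a in 𝓝 (0 : E), f a ∈ {w | ∃ u ∈ expProducts X, w = R u v} := by
    have h1 : Filter.Tendsto (fun a => NormedSpace.exp (J a)) (𝓝 0) (𝓝 1) := by
      have := hJexp.continuousAt.tendsto
      simpa using this
    filter_upwards [h1.eventually hK] with a ha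
    exact ⟨_, ha (hJu a), rfl⟩
  have hSf : ∀ s ∈ 𝓝 (0 : E), ∀ᶠ w in 𝓝 (f 0),
      w ∈ {w | ∃ u ∈ expProducts X, w = R u v} → ∃ a ∈ s, w = f a := by
    intro s hs
    -- The stabilizer algebra. Near `1` a unitary is `exp (J a) * exp Y` with `Y ∈ 𝔨`, and the
    -- second factor fixes `v`.
    let 𝔨 := LinearMap.ker T
    let J₂ : 𝔨 →L[ℝ] A := 𝔤.subtypeL ∘L 𝔨.subtypeL
    have h4 := eventually_mem_unitary_imp_exists_exp_mul_exp (F := 𝔨) (J := J) (J' := J₂)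
      (fun a => h𝔤 _ (j a).2) (fun Y => h𝔤 _ (Y : 𝔤).2) (fun x hx => ?_) hs
    · have h5 := eventually_mem_orbit_imp (isCompact_expProducts hX hspan)
        (expProducts_subset_unitary hX) (fun _ hu _ hv => mul_mem_expProducts hu hv)
        (fun _ hu => star_mem_expProducts hX hu) hR.continuous v h4
      rw [hf0]
      filter_upwards [h5] with w hw hwO
      obtain ⟨u, ⟨huK, hu⟩, rfl⟩ := hw hwO
      obtain ⟨a, ha, Y, rfl⟩ := hu (expProducts_subset_unitary hX huK)
      refine ⟨a, ha, ?_⟩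
      have hY : R' (J₂ Y) v = 0 := Y.2
      rw [map_mul, mul_apply_eq_comp, monoidHom_exp_apply_eq_self hR' hY]
    · let x' : 𝔤 := ⟨x, hspan x hx⟩
      let a := b.symm ⟨T x', x', rfl⟩
      refine ⟨a, ⟨x' - j a, ?_⟩, ?_⟩
      · rw [LinearMap.mem_ker, map_sub, hj]
        simp [a]
      · simp [J, J₂, x']
  obtain ⟨e, he, hve⟩ := exists_isSliceChart_of_localParametrization hfc hfd
    (q := C.subtypeL) (L := L) hL hfS hSf
  rw [hf0] at hve
  refine isEmbeddedSubmanifold_of_isSliceChart L ?_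
  rintro _ ⟨g, hg, rfl⟩
  have hgu := expProducts_subset_unitary hX hg
  have hg1 : ∀ w, R (star g) (R g w) = w := fun w => by
    rw [← mul_apply_eq_comp, ← map_mul, Unitary.star_mul_self_of_mem hgu]; simp
  have hg2 : ∀ w, R g (R (star g) w) = w := fun w => by
    rw [← mul_apply_eq_comp, ← map_mul, Unitary.mul_star_self_of_mem hgu]; simp
  -- `Φ` moves `R g v` back to `v` and preserves the orbit, so it transports the slice chart at `v`.
  let Φ : V ≃L[ℝ] V := ContinuousLinearEquiv.equivOfInverse (R (star g)) (R g) hg2 hg1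
  have hΦ : ∀ w, Φ w = R (star g) w := fun w => rfl
  refine ⟨Φ.toHomeomorph.toOpenPartialHomeomorph.trans e, ⟨?_, ?_, ?_⟩, ?_⟩
  · have h1 := he.contDiffOn.comp (Φ.contDiff.contDiffOn (s := Φ ⁻¹' e.source)) fun a ha => ha
    exact h1.mono fun y hy => by simpa using hy
  · have h1 := Φ.symm.contDiff.comp_contDiffOn he.contDiffOn_symm
    exact h1.mono fun y hy => by simpa using hy
  · intro w hw
    have hw' : Φ w ∈ e.source := by simpa using hw
    have h1 := he.mem_iff _ hw'
    refine Iff.trans ?_ h1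
    constructor
    · rintro ⟨u, hu, rfl⟩
      exact ⟨star g * u, mul_mem_expProducts (star_mem_expProducts hX hg) hu, by simp [hΦ]⟩
    · rintro ⟨u, hu, h⟩
      refine ⟨g * u, mul_mem_expProducts hg hu, ?_⟩
      rw [map_mul, mul_apply_eq_comp, ← h, hΦ, hg2]
  · simpa [hΦ, hg1] using hve

end OrbitChart

/-! ### The Bargmann picture: Fock vectors as polynomials. -/

section Bargmann

open MvPolynomial

variable {m : ℕ}

/-- The linear substitution `x_j ↦ ∑ k, u k j x_k`. -/
def substitution (u : Matrix (Fin m) (Fin m) ℂ) :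
    MvPolynomial (Fin m) ℂ →ₐ[ℂ] MvPolynomial (Fin m) ℂ :=
  aeval fun j => ∑ k, u k j • X k

lemma substitution_X (u : Matrix (Fin m) (Fin m) ℂ) (j : Fin m) :
    substitution u (X j) = ∑ k, u k j • X k := by simp [substitution]

lemma substitution_one : substitution (1 : Matrix (Fin m) (Fin m) ℂ) = AlgHom.id ℂ _ := by
  ext j : 1
  rw [substitution_X]
  simp [Matrix.one_apply]

lemma substitution_mul (u w : Matrix (Fin m) (Fin m) ℂ) :
    substitution (u * w) = (substitution u).comp (substitution w) := by
  ext j : 1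
  rw [substitution_X, AlgHom.comp_apply, substitution_X, map_sum]
  simp only [map_smul, substitution_X, Matrix.mul_apply, Finset.sum_smul, Finset.smul_sum, smul_smul]
  rw [Finset.sum_comm]
  simp only [mul_comm]

/-- The derivation `∑ k j, x k j X_k ∂_j`, with `x_j ↦ ∑ k, x k j x_k`. -/
def linearDerivation :
    Matrix (Fin m) (Fin m) ℂ →ₗ[ℂ] Derivation ℂ (MvPolynomial (Fin m) ℂ) (MvPolynomial (Fin m) ℂ) where
  toFun x := mkDerivation ℂ fun j => ∑ k, x k j • X k
  map_add' x y := derivation_ext fun j => by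
    simp [mkDerivation_X, add_smul, Finset.sum_add_distrib]
  map_smul' c x := derivation_ext fun j => by
    simp [mkDerivation_X, Finset.smul_sum, mul_smul]

lemma linearDerivation_X (x : Matrix (Fin m) (Fin m) ℂ) (j : Fin m) :
    linearDerivation x (X j) = ∑ k, x k j • X k :=
  mkDerivation_X _ _ _

lemma linearDerivation_single (k l : Fin m) (p : MvPolynomial (Fin m) ℂ) :
    linearDerivation (Matrix.single k l 1) p = X k * pderiv l p := by
  have : linearDerivation (Matrix.single k l (1 : ℂ))
      = (X k : MvPolynomial (Fin m) ℂ) • pderiv l := by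
    refine derivation_ext fun j => ?_
    rw [linearDerivation_X, Finset.sum_eq_single k]
    · by_cases h : l = j
      · subst h; simp
      · simp [h, pderiv_X, Ne.symm h]
    · intro b _ hb; simp [Ne.symm hb]
    · simp
  rw [this]; simp

/-- Differentiating an algebra homomorphism at the identity gives a derivation, so only the
variables need checking. Working with coefficients avoids a topology on polynomials. -/
lemma hasDerivAt_coeff_substitution (x : Matrix (Fin m) (Fin m) ℂ) (p : MvPolynomial (Fin m) ℂ) :
    ∀ d, HasDerivAt (fun t : ℝ => coeff d (substitution (1 + (t : ℂ) • x) p))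
      (coeff d (linearDerivation x p)) 0 := by
  induction p using MvPolynomial.induction_on with
  | C a =>
    intro d
    simpa [MvPolynomial.algHom_C] using hasDerivAt_const (0 : ℝ) (coeff d (C a : MvPolynomial (Fin m) ℂ))
  | add p q hp hq =>
    intro d
    simpa only [map_add, coeff_add] using (hp d).fun_add (hq d)
  | mul_X p j hp =>
    intro d
    have hX : ∀ d, HasDerivAt (fun t : ℝ => coeff d (substitution (1 + (t : ℂ) • x) (X j)))
        (coeff d (linearDerivation x (X j))) 0 := fun d => by
      simp only [substitution_X, linearDerivation_X, coeff_sum, coeff_smul]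
      refine HasDerivAt.fun_sum fun k _ => ?_
      refine HasDerivAt.smul_const ?_ _
      simp only [Matrix.add_apply, Matrix.smul_apply, smul_eq_mul]
      have h1 : HasDerivAt (fun t : ℝ => (t : ℂ)) 1 (0 : ℝ) := Complex.ofRealCLM.hasDerivAt
      simpa using (h1.mul_const (x k j)).const_add ((1 : Matrix (Fin m) (Fin m) ℂ) k j)
    have h0 : substitution (1 + ((0 : ℝ) : ℂ) • x) = AlgHom.id ℂ _ := by
      simp [substitution_one]
    simp only [map_mul, Derivation.leibniz, smul_eq_mul, coeff_add]
    rw [mul_comm (X j) (linearDerivation x p)]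
    simp only [coeff_mul]
    rw [← Finset.sum_add_distrib]
    refine HasDerivAt.fun_sum fun e _ => ?_
    refine ((hp e.1).mul (hX e.2)).congr_deriv ?_
    rw [h0, AlgHom.id_apply, AlgHom.id_apply, add_comm]

/-- The normalisation `√(n₁! ⋯ n_m!)` of the monomial `x^n`. -/
def occNorm (n : Occ m) : ℂ := ((√(∏ k, ((n k).factorial : ℝ)) : ℝ) : ℂ)

lemma occNorm_ne_zero (n : Occ m) : occNorm n ≠ 0 := by
  rw [occNorm, Complex.ofReal_ne_zero, Real.sqrt_ne_zero']
  exact Finset.prod_pos fun k _ => by positivity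

/-- The exponent of the monomial `x^n`. -/
abbrev expo (n : Occ m) : Fin m →₀ ℕ := Finsupp.equivFunOnFinite.symm n

/-- The polynomial `x^n / √(n!)` representing `|n⟩`. -/
def fockMonomial (n : Occ m) : MvPolynomial (Fin m) ℂ := monomial (expo n) (occNorm n)⁻¹

/-- The coefficient of a polynomial with respect to `x^n / √(n!)`. -/
def fockCoeff (n : Occ m) (p : MvPolynomial (Fin m) ℂ) : ℂ := occNorm n * coeff (expo n) p

/-- The polynomial representing a vector of Fock space. -/
def toPolynomial : FiniteFock m →ₗ[ℂ] MvPolynomial (Fin m) ℂ :=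
  Finsupp.linearCombination ℂ fockMonomial

lemma toPolynomial_single (n : Occ m) (c : ℂ) :
    toPolynomial (Finsupp.single n c) = c • fockMonomial n := by simp [toPolynomial]

lemma fockCoeff_fockMonomial (n n' : Occ m) :
    fockCoeff n (fockMonomial n') = if n' = n then 1 else 0 := by
  rw [fockCoeff, fockMonomial, coeff_monomial]
  by_cases h : n' = n
  · subst h; simp [occNorm_ne_zero]
  · simp [h]

lemma fockCoeff_toPolynomial (n : Occ m) (v : FiniteFock m) :
    fockCoeff n (toPolynomial v) = v n := by
  induction v using Finsupp.induction_linear with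
  | zero => simp [fockCoeff]
  | add f g hf hg => 
    rw [map_add, Finsupp.add_apply, ← hf, ← hg]
    simp [fockCoeff, mul_add]
  | single n' c =>
    rw [toPolynomial_single]
    have : fockCoeff n (c • fockMonomial n') = c * fockCoeff n (fockMonomial n') := by
      simp [fockCoeff]; ring
    rw [this, fockCoeff_fockMonomial, Finsupp.single_apply]
    simp

lemma expo_update_add_one (n : Occ m) (k : Fin m) :
    expo (Function.update n k (n k + 1)) = expo n + Finsupp.single k 1 := by
  ext j
  by_cases h : j = k
  · subst h; simp
  · simp [h]

lemma expo_update_sub_one (n : Occ m) (k : Fin m) :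
    expo (Function.update n k (n k - 1)) = expo n - Finsupp.single k 1 := by
  ext j
  by_cases h : j = k
  · subst h; simp
  · simp [h]

lemma occNorm_update_add_one (n : Occ m) (k : Fin m) :
    occNorm (Function.update n k (n k + 1)) = ((√((n k : ℝ) + 1) : ℝ) : ℂ) * occNorm n := by
  rw [occNorm, occNorm, ← Complex.ofReal_mul, ← Real.sqrt_mul (by positivity)]
  congr 2
  rw [← Finset.mul_prod_erase _ _ (Finset.mem_univ k),
    ← Finset.mul_prod_erase Finset.univ (fun k => ((n k).factorial : ℝ)) (Finset.mem_univ k),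
    ← mul_assoc]
  congr 1
  · simp [Nat.factorial_succ]
  · refine Finset.prod_congr rfl fun j hj => ?_
    rw [Function.update_of_ne (Finset.ne_of_mem_erase hj)]

/-- The normalisation `1 / √(n!)` absorbs the factor `√(n k + 1)`. -/
lemma toPolynomial_creation (k : Fin m) (v : FiniteFock m) :
    toPolynomial (creation k v) = X k * toPolynomial v := by
  induction v using Finsupp.induction_linear with
  | zero => simp
  | add f g hf hg => simp [hf, hg, mul_add]
  | single n c =>
    simp only [creation, Finsupp.linearCombination_single, map_smul, toPolynomial_single,
      fockMonomial, mul_smul_comm]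
    congr 1
    rw [expo_update_add_one, occNorm_update_add_one, X, monomial_mul, smul_monomial, add_comm]
    congr 1
    have : ((√((n k : ℝ) + 1) : ℝ) : ℂ) ≠ 0 := by
      rw [Complex.ofReal_ne_zero, Real.sqrt_ne_zero']; positivity
    have := occNorm_ne_zero n
    rw [smul_eq_mul]
    field_simp

lemma toPolynomial_annihilation (k : Fin m) (v : FiniteFock m) :
    toPolynomial (annihilation k v) = pderiv k (toPolynomial v) := by
  induction v using Finsupp.induction_linear with
  | zero => simp
  | add f g hf hg => simp [hf, hg]
  | single n c =>
    simp only [annihilation, Finsupp.linearCombination_single, map_smul, toPolynomial_single,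
      fockMonomial]
    rw [Derivation.map_smul]
    congr 1
    rw [expo_update_sub_one, pderiv_monomial, smul_monomial]
    congr 1
    -- For `n k = 0` the truncated `n k - 1` is harmless, since both coefficients vanish. Otherwise
    -- `n` is `n₀` with one photon added, and the recursion for `occNorm` applies at `n₀`.
    rcases Nat.eq_zero_or_pos (n k) with h0 | h0
    · simp [h0]
    · set n₀ := Function.update n k (n k - 1) with hn₀
      have h1 : n = Function.update n₀ k (n₀ k + 1) := by
        ext j
        by_cases h : j = k
        · subst h; simp [hn₀]; omega
        · simp [hn₀, h]
      have h2 : n₀ k + 1 = n k := by simp [hn₀]; omega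
      have h3 := occNorm_update_add_one n₀ k
      rw [← h1] at h3
      have h4 : ((√((n₀ k : ℝ) + 1) : ℝ) : ℂ) = ((√(n k : ℝ) : ℝ) : ℂ) := by
        rw [← h2]; push_cast; rfl
      have h5 : ((√(n k : ℝ) : ℝ) : ℂ) ≠ 0 := by
        rw [Complex.ofReal_ne_zero, Real.sqrt_ne_zero']; exact_mod_cast h0
      have h6 : ((√(n k : ℝ) : ℝ) : ℂ) * ((√(n k : ℝ) : ℝ) : ℂ) = (n k : ℂ) := by
        rw [← Complex.ofReal_mul, Real.mul_self_sqrt (by positivity)]; simp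
      have h7 := occNorm_ne_zero n₀
      rw [h3, h4, smul_eq_mul]
      have h8 : (expo n) k = n k := rfl
      rw [h8, ← h6]
      field_simp

/-- The skew-adjoint matrices corresponding to `-i H_I`. -/
def generator : PLOIndex m → Matrix (Fin m) (Fin m) ℂ
  | .e k l _ => (-Complex.I / 2) • (Matrix.single k l 1 + Matrix.single l k 1)
  | .E k l _ => (1 / 2 : ℂ) • (Matrix.single k l 1 - Matrix.single l k 1)
  | .N k => -Complex.I • Matrix.single k k 1

lemma linearDerivation_generator (I : PLOIndex m) (v : FiniteFock m) :
    linearDerivation (generator I) (toPolynomial v)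
      = toPolynomial (-Complex.I • hamiltonian I v) := by
  have h : ∀ k l : Fin m, X k * pderiv l (toPolynomial v)
      = toPolynomial ((creation k * annihilation l : Module.End ℂ (FiniteFock m)) v) := fun k l => by
    rw [Module.End.mul_apply, toPolynomial_creation, toPolynomial_annihilation]
  cases I with
  | e k l _ =>
    simp only [generator, hamiltonian, map_smul, map_add, Derivation.smul_apply,
      Derivation.add_apply, linearDerivation_single, h, LinearMap.smul_apply, LinearMap.add_apply,
      smul_smul]
    congr 1; ring
  | E k l _ =>
    simp only [generator, hamiltonian, map_smul, map_sub, Derivation.smul_apply,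
      Derivation.sub_apply, linearDerivation_single, h, LinearMap.smul_apply, LinearMap.sub_apply,
      smul_smul]
    congr 1
    linear_combination (1 / 2 : ℂ) * Complex.I_mul_I
  | N k =>
    simp only [generator, hamiltonian, map_smul, Derivation.smul_apply,
      linearDerivation_single, h]

lemma generator_mem_skewAdjoint (I : PLOIndex m) : generator I ∈ skewAdjoint (Matrix (Fin m) (Fin m) ℂ) := by
  rw [skewAdjoint.mem_iff, Matrix.star_eq_conjTranspose]
  cases I with
  | e k l _ => 
    rw [generator, Matrix.conjTranspose_smul, ← neg_smul]
    simp only [Matrix.conjTranspose_add, Matrix.conjTranspose_single, star_one, add_comm]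
    congr 1
    simp [neg_div]
  | E k l _ => simp [generator, Matrix.conjTranspose_smul, Matrix.conjTranspose_single, ← smul_neg]
  | N k =>
    rw [generator, Matrix.conjTranspose_smul, ← neg_smul]
    simp only [Matrix.conjTranspose_single, star_one]
    congr 1
    simp

/-- For skew-adjoint `x`, `2x = x - star x` is a sum of elementary pieces `z E_kl - z̄ E_lk`. The
real and imaginary parts of `z` are the coefficients of the `E` and `e` generators, and the diagonal
pieces are multiples of the `N` generators. -/
lemma mem_span_generator {x : Matrix (Fin m) (Fin m) ℂ} (hx : x ∈ skewAdjoint (Matrix (Fin m) (Fin m) ℂ)) :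
    x ∈ Submodule.span ℝ (Set.range (generator (m := m))) := by
  set S := Submodule.span ℝ (Set.range (generator (m := m)))
  have hS : ∀ I, generator I ∈ S := fun I => Submodule.subset_span ⟨I, rfl⟩
  have hlt : ∀ (k l : Fin m) (_ : k < l) (z : ℂ),
      Matrix.single k l z - Matrix.single l k (star z) ∈ S := fun k l h z => by
    have : Matrix.single k l z - Matrix.single l k (star z)
        = (2 * z.re) • generator (.E k l h) + (-2 * z.im) • generator (.e k l h) := by
      have hz := Complex.re_add_im z
      ext a b
      simp only [generator, Matrix.sub_apply, Matrix.add_apply, Matrix.smul_apply, Matrix.single_apply,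
        Complex.real_smul, smul_eq_mul, Complex.star_def]
      split_ifs <;> (apply Complex.ext <;> simp <;> ring)
    rw [this]
    exact S.add_mem (S.smul_mem _ (hS _)) (S.smul_mem _ (hS _))
  have hall : ∀ (k l : Fin m) (z : ℂ),
      Matrix.single k l z - Matrix.single l k (star z) ∈ S := fun k l z => by
    rcases lt_trichotomy k l with h | rfl | h
    · exact hlt k l h z
    · have : Matrix.single k k z - Matrix.single k k (star z)
          = (-2 * z.im) • generator (.N k) := by
        ext a b
        simp only [generator, Matrix.sub_apply, Matrix.smul_apply, Matrix.single_apply,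
          Complex.real_smul, smul_eq_mul, Complex.star_def]
        split_ifs <;> (apply Complex.ext <;> simp <;> ring)
      rw [this]
      exact S.smul_mem _ (hS _)
    · have := S.neg_mem (hlt l k h (star z))
      rwa [neg_sub, star_star] at this
  have h1 : (2 : ℝ) • x = ∑ k, ∑ l, (Matrix.single k l (x k l) - Matrix.single l k (star (x k l))) := by
    have h2 : star x = -x := hx
    have h3 : ∑ k, ∑ l, Matrix.single l k (star (x k l)) = star x := by
      rw [Finset.sum_comm, Matrix.matrix_eq_sum_single (star x)]
      simp [Matrix.star_apply]
    simp only [Finset.sum_sub_distrib]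
    rw [h3, ← Matrix.matrix_eq_sum_single, h2, two_smul, sub_neg_eq_add]
  have h2 : x = (2⁻¹ : ℝ) • (2 : ℝ) • x := by rw [smul_smul]; norm_num
  rw [h2, h1]
  exact S.smul_mem _ (S.sum_mem fun k _ => S.sum_mem fun l _ => hall k l _)

end Bargmann

/-! ### Second quantization on the cutoff space. -/

section Representation

open MvPolynomial

open scoped Matrix.Norms.L2Operator

variable {m : ℕ}

lemma contDiff_coeff_substitution (p : MvPolynomial (Fin m) ℂ) :
    ∀ d, ContDiff ℝ ω fun u : Matrix (Fin m) (Fin m) ℂ => coeff d (substitution u p) := by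
  induction p using MvPolynomial.induction_on with
  | C a =>
    intro d
    simpa [MvPolynomial.algHom_C] using contDiff_const
  | add p q hp hq =>
    intro d
    simpa only [map_add, coeff_add] using (hp d).add (hq d)
  | mul_X p j hp =>
    intro d
    have hX : ∀ d, ContDiff ℝ ω fun u : Matrix (Fin m) (Fin m) ℂ =>
        coeff d (substitution u (X j)) := fun d => by
      simp only [substitution_X, coeff_sum, coeff_smul, smul_eq_mul]
      refine ContDiff.sum fun k _ => ContDiff.mul ?_ contDiff_const
      exact ((Matrix.entryLinearMap ℝ ℂ k j).toContinuousLinearMap).contDiff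
    simp only [map_mul, coeff_mul]
    exact ContDiff.sum fun e _ => (hp e.1).mul (hX e.2)

/-- The matrix of the second quantization of `u` in the Fock basis. -/
def repMatrix (N : ℕ) (u : Matrix (Fin m) (Fin m) ℂ) :
    Matrix (CutoffOcc m N) (CutoffOcc m N) ℂ :=
  Matrix.of fun n n' => fockCoeff n.1 (substitution u (fockMonomial n'.1))

lemma repMatrix_one (N : ℕ) : repMatrix N (1 : Matrix (Fin m) (Fin m) ℂ) = 1 := by
  ext n n'
  simp only [repMatrix, Matrix.of_apply, substitution_one, AlgHom.id_apply, fockCoeff_fockMonomial,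
    Matrix.one_apply, Subtype.ext_iff, eq_comm]

lemma isHomogeneous_substitution_fockMonomial (u : Matrix (Fin m) (Fin m) ℂ) (n : Occ m) :
    (substitution u (fockMonomial n)).IsHomogeneous (∑ k, n k) := by
  have h1 : (fockMonomial n).IsHomogeneous (∑ k, n k) := by
    refine isHomogeneous_monomial _ ?_
    rw [Finsupp.degree_eq_sum]
    rfl
  have h2 := h1.aeval (n := 1) (fun j => ∑ k, u k j • (X k : MvPolynomial (Fin m) ℂ)) fun j => by
    refine IsHomogeneous.sum _ _ _ fun k _ => ?_
    rw [smul_eq_C_mul]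
    exact (isHomogeneous_X ℂ k).C_mul _
  rwa [one_mul] at h2

lemma sum_fockCoeff_smul_fockMonomial {N d : ℕ} (hd : d ≤ N) {p : MvPolynomial (Fin m) ℂ}
    (hp : p.IsHomogeneous d) :
    ∑ n : CutoffOcc m N, fockCoeff n.1 p • fockMonomial n.1 = p := by
  ext e
  simp only [coeff_sum, coeff_smul, fockMonomial, coeff_monomial, smul_eq_mul, fockCoeff]
  by_cases he : ∑ k, e k ≤ N
  · rw [Finset.sum_eq_single (⟨fun k => e k, he⟩ : CutoffOcc m N)]
    · have h1 : expo (fun k => e k) = e := by ext; rfl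
      have h2 := occNorm_ne_zero fun k => e k
      rw [h1, if_pos rfl]
      field_simp
    · intro n _ hn
      rw [if_neg, mul_zero]
      rintro rfl
      exact hn (Subtype.ext rfl)
    · simp
  · have h0 : coeff e p = 0 := hp.coeff_eq_zero (by rw [Finsupp.degree_eq_sum]; omega)
    rw [h0]
    refine Finset.sum_eq_zero fun n _ => ?_
    rw [if_neg, mul_zero]
    rintro rfl
    exact he n.2

/-- Linear substitutions preserve the degree, so no term leaves the cutoff and truncation commutes
with composition. -/
lemma repMatrix_mul (N : ℕ) (u w : Matrix (Fin m) (Fin m) ℂ) :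
    repMatrix N (u * w) = repMatrix N u * repMatrix N w := by
  ext n n'
  have h := sum_fockCoeff_smul_fockMonomial n'.2
    (isHomogeneous_substitution_fockMonomial w n'.1)
  simp only [repMatrix, Matrix.of_apply, Matrix.mul_apply, substitution_mul, AlgHom.comp_apply]
  conv_lhs => rw [← h]
  simp only [map_sum, map_smul, fockCoeff, coeff_sum, coeff_smul, smul_eq_mul, Finset.mul_sum]
  refine Finset.sum_congr rfl fun a _ => ?_
  ring

/-- The representation of the matrices `u` on the cutoff space by second quantization. -/
def rep (m N : ℕ) : Matrix (Fin m) (Fin m) ℂ →* CutoffOp m N where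
  toFun u := Matrix.toEuclideanCLM (n := CutoffOcc m N) (𝕜 := ℂ) (repMatrix N u)
  map_one' := by rw [repMatrix_one, map_one]
  map_mul' u w := by rw [repMatrix_mul, map_mul]

lemma toEuclideanCLM_eq_sum {n : Type*} [Fintype n] [DecidableEq n] (x : Matrix n n ℂ) :
    Matrix.toEuclideanCLM (n := n) (𝕜 := ℂ) x
      = ∑ i, ∑ j, x i j • Matrix.toEuclideanCLM (n := n) (𝕜 := ℂ) (Matrix.single i j 1) := by
  conv_lhs => rw [Matrix.matrix_eq_sum_single x]
  simp only [map_sum, ← map_smul, Matrix.smul_single, smul_eq_mul, mul_one]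

lemma contDiff_rep (m N : ℕ) : ContDiff ℝ ω (rep m N) := by
  have : (rep m N : Matrix (Fin m) (Fin m) ℂ → CutoffOp m N) = fun u => ∑ i, ∑ j,
      repMatrix N u i j •
        Matrix.toEuclideanCLM (n := CutoffOcc m N) (𝕜 := ℂ) (Matrix.single i j 1) :=
    funext fun u => toEuclideanCLM_eq_sum _
  rw [this]
  refine ContDiff.sum fun i _ => ContDiff.sum fun j _ => ContDiff.fun_smul ?_ contDiff_const
  exact contDiff_const.mul (contDiff_coeff_substitution _ _)

/-- It suffices to differentiate along the line `1 + t • generator I`; the entries are polynomial in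
the matrix, so no exponential is needed. -/
lemma fderiv_rep_generator (N : ℕ) (I : PLOIndex m) :
    fderiv ℝ (rep m N) 1 (generator I) = -Complex.I • cutoffHamiltonian I := by
  have h1 : HasDerivAt (fun t : ℝ => rep m N (1 + t • generator I))
      (fderiv ℝ (rep m N) 1 (generator I)) 0 := by
    have h2 : HasDerivAt (fun t : ℝ => 1 + t • generator I) (generator I) 0 := by
      simpa using ((hasDerivAt_id (0 : ℝ)).smul_const (generator I)).const_add
        (1 : Matrix (Fin m) (Fin m) ℂ)
    have h3 : HasFDerivAt (rep m N) (fderiv ℝ (rep m N) 1) (1 + (0 : ℝ) • generator I) := by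
      rw [zero_smul, add_zero]
      exact ((contDiff_rep m N).differentiable (by simp)).differentiableAt.hasFDerivAt
    exact h3.comp_hasDerivAt (0 : ℝ) h2
  refine h1.unique ?_
  have h4 : (fun t : ℝ => rep m N (1 + t • generator I)) = fun t : ℝ => ∑ i, ∑ j,
      repMatrix N (1 + (t : ℂ) • generator I) i j •
        Matrix.toEuclideanCLM (n := CutoffOcc m N) (𝕜 := ℂ) (Matrix.single i j 1) :=
    funext fun t => toEuclideanCLM_eq_sum _
  have h5 : -Complex.I • cutoffHamiltonian (N := N) I
      = Matrix.toEuclideanCLM (n := CutoffOcc m N) (𝕜 := ℂ) (Matrix.of fun n n' =>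
          -Complex.I * hamiltonian I (Finsupp.single n'.1 1) n.1) := by
    rw [cutoffHamiltonian, ← map_smul]
    rfl
  rw [h4, h5, toEuclideanCLM_eq_sum]
  refine HasDerivAt.fun_sum fun i _ => HasDerivAt.fun_sum fun j _ => ?_
  have h7 := toPolynomial_single j.1 1
  rw [one_smul] at h7
  have h6 : HasDerivAt (fun t : ℝ => repMatrix N (1 + (t : ℂ) • generator I) i j)
      (-Complex.I * hamiltonian I (Finsupp.single j.1 1) i.1) 0 := by
    refine ((hasDerivAt_coeff_substitution (generator I) (fockMonomial j.1)
      (expo i.1)).const_mul (occNorm i.1)).congr_deriv ?_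
    rw [← h7, linearDerivation_generator]
    exact fockCoeff_toPolynomial _ _
  exact h6.smul_const (Matrix.toEuclideanCLM (n := CutoffOcc m N) (𝕜 := ℂ) (Matrix.single i j 1))

/-- Comparing the two occupations after removing one photon from each makes the formula symmetric
under exchanging `(k, n)` with `(l, n')`, which yields the self-adjointness of the Hamiltonians. -/
lemma creation_annihilation_single (k l : Fin m) (n n' : Occ m) :
    (creation k * annihilation l : Module.End ℂ (FiniteFock m)) (Finsupp.single n' 1) n
      = ((√(n' l : ℝ) : ℝ) : ℂ) * ((√(n k : ℝ) : ℝ) : ℂ) *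
        if Function.update n' l (n' l - 1) = Function.update n k (n k - 1) then 1 else 0 := by
  simp only [Module.End.mul_apply, annihilation, creation, Finsupp.linearCombination_single,
    one_smul, Finsupp.smul_apply, smul_eq_mul, Finsupp.single_apply, mul_assoc]
  congr 1
  set a := Function.update n' l (n' l - 1)
  by_cases h : Function.update a k (a k + 1) = n
  · have h1 : n k = a k + 1 := by rw [← h]; simp
    have h2 : a = Function.update n k (n k - 1) := by
      rw [h1, ← h]; simp
    rw [if_pos h, if_pos h2, h1]
    simp
  · rw [if_neg h]
    by_cases h2 : a = Function.update n k (n k - 1)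
    -- The two conditions differ only through truncated subtraction at `n k = 0`, where the factor
    -- `√(n k)` vanishes.
    · have h3 : n k = 0 := by
        by_contra h4
        apply h
        rw [h2]
        have : n k - 1 + 1 = n k := by omega
        simp [this]
      simp [h3]
    · simp [h2]

lemma star_cutoffHamiltonian {N : ℕ} (I : PLOIndex m) :
    star (cutoffHamiltonian I : CutoffOp m N) = cutoffHamiltonian I := by
  rw [cutoffHamiltonian, ← map_star]
  congr 1
  ext n n'
  have h : ∀ k l : Fin m, star
      ((creation k * annihilation l : Module.End ℂ (FiniteFock m)) (Finsupp.single n.1 1) n'.1)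
      = (creation l * annihilation k : Module.End ℂ (FiniteFock m)) (Finsupp.single n'.1 1) n.1 := by
    intro k l
    rw [creation_annihilation_single, creation_annihilation_single]
    simp only [eq_comm (a := Function.update n.1 l _)]
    split_ifs <;> simp [mul_comm]
  rw [Matrix.star_apply, Matrix.of_apply, Matrix.of_apply]
  cases I with
  | e k l _ =>
    simp only [hamiltonian, LinearMap.smul_apply, LinearMap.add_apply, Finsupp.smul_apply,
      Finsupp.add_apply, star_smul, star_add, h]
    rw [add_comm]
    simp
  | E k l _ =>
    simp only [hamiltonian, LinearMap.smul_apply, LinearMap.sub_apply, Finsupp.smul_apply,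
      Finsupp.sub_apply, star_smul, star_sub, h]
    simp
    ring
  | N k => simp only [hamiltonian, h]

lemma evolution_eq_rep {N : ℕ} (I : PLOIndex m) (t : ℝ) :
    (evolution I t : CutoffOp m N) = rep m N (NormedSpace.exp (t • generator I)) := by
  rw [monoidHom_exp_smul ((contDiff_rep m N).differentiable (by simp)).differentiableAt.hasFDerivAt,
    fderiv_rep_generator, evolution]
  congr 1
  rw [← Complex.coe_smul, smul_smul]
  congr 1
  ring

lemma ploGroup_eq_image (m N : ℕ) :
    ploGroup m N = rep m N '' expProducts (generator (m := m)) := by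
  have h : ∀ L : List (PLOIndex m × ℝ), (L.map fun p => (evolution p.1 p.2 : CutoffOp m N)).prod
      = rep m N (L.map fun p => NormedSpace.exp (p.2 • generator p.1)).prod := fun L => by
    rw [map_list_prod, List.map_map]
    simp [Function.comp_def, evolution_eq_rep]
  ext U
  constructor
  · rintro ⟨L, rfl⟩
    exact ⟨_, ⟨L, rfl⟩, (h L).symm⟩
  · rintro ⟨_, ⟨L, rfl⟩, rfl⟩
    exact ⟨L, (h L).symm⟩

end Representation

/-! ### Ranks and Gram matrices. -/

section Gram

/-- The rank of a list of vectors is the rank of its Gram matrix for a definite bilinear form. -/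
lemma finrank_range_eq_rank_gram {V ι : Type*} [AddCommGroup V] [Module ℝ V] [Fintype ι]
    (B : V →ₗ[ℝ] V →ₗ[ℝ] ℝ) (hB : ∀ x, B x x = 0 → x = 0) (v : ι → V) :
    Set.finrank ℝ (Set.range v) = (Matrix.of fun i j => B (v i) (v j)).rank := by
  set G : Matrix ι ι ℝ := Matrix.of fun i j => B (v i) (v j)
  let T : (ι → ℝ) →ₗ[ℝ] V := Fintype.linearCombination ℝ v
  have hG : ∀ c i, (G.mulVecLin c) i = B (v i) (T c) := fun c i => by
    simp [G, T, Matrix.mulVec, dotProduct, Fintype.linearCombination_apply, mul_comm]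
  have hker : LinearMap.ker G.mulVecLin = LinearMap.ker T := by
    ext c
    rw [LinearMap.mem_ker, LinearMap.mem_ker]
    constructor
    -- If `G c = 0`, then `B (T c) (T c)`, the quadratic form of `G` at `c`, vanishes, and
    -- definiteness gives `T c = 0`. Equal kernels give equal ranks by rank–nullity.
    · intro h
      apply hB
      have h1 : B (T c) (T c) = ∑ i, c i * B (v i) (T c) := by
        have h2 : ∀ y, B (T c) y = ∑ i, c i * B (v i) y := fun y => by
          simp [T, Fintype.linearCombination_apply]
        exact h2 _
      rw [h1]
      refine Finset.sum_eq_zero fun i _ => ?_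
      rw [← hG, h]
      simp
    · intro h
      ext i
      rw [hG, h]
      simp
  have h1 := LinearMap.finrank_range_add_finrank_ker T
  have h2 := LinearMap.finrank_range_add_finrank_ker G.mulVecLin
  rw [hker] at h2
  have h3 : LinearMap.range T = Submodule.span ℝ (Set.range v) :=
    Fintype.range_linearCombination ℝ v
  rw [Matrix.rank, Set.finrank, ← h3]
  omega

lemma finrank_range_linearEquiv {V ι : Type*} [AddCommGroup V] [Module ℝ V]
    (e : V ≃ₗ[ℝ] V) (v : ι → V) :
    Set.finrank ℝ (Set.range fun i => e (v i)) = Set.finrank ℝ (Set.range v) := by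
  have h : (Set.range fun i => e (v i)) = e '' Set.range v := by rw [← Set.range_comp]; rfl
  rw [Set.finrank, Set.finrank, h]
  have h2 := Submodule.map_span (e : V →ₗ[ℝ] V) (Set.range v)
  rw [LinearEquiv.coe_coe] at h2
  rw [← h2]
  exact LinearEquiv.finrank_map_eq e _

/-- Multiplication by `-i` as a real-linear automorphism. -/
def negIEquiv (V : Type*) [AddCommGroup V] [Module ℂ V] : V ≃ₗ[ℝ] V :=
  (LinearEquiv.smulOfNeZero ℂ V (-Complex.I) (by simp)).restrictScalars ℝ

lemma negIEquiv_apply {V : Type*} [AddCommGroup V] [Module ℂ V] (x : V) :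
    negIEquiv V x = -Complex.I • x := rfl

variable {m N : ℕ}

lemma ketRank_eq_rank_ketGram (ψ : CutoffSpace m N) : ketRank ψ = (ketGram ψ).rank := by
  let B : CutoffSpace m N →ₗ[ℝ] CutoffSpace m N →ₗ[ℝ] ℝ :=
    LinearMap.mk₂ ℝ (fun x y => (⟪x, y⟫_ℂ).re)
      (fun x y z => by simp) (fun c x y => by
        rw [← Complex.coe_smul, inner_smul_left]; simp)
      (fun x y z => by simp) (fun c x y => by
        rw [← Complex.coe_smul, inner_smul_right]; simp)
  refine finrank_range_eq_rank_gram B (fun x hx => ?_) _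
  have h1 : (⟪x, x⟫_ℂ).re = 0 := hx
  have h2 := inner_self_eq_norm_sq (𝕜 := ℂ) x
  rw [RCLike.re_eq_complex_re, h1] at h2
  simpa using h2.symm

lemma hsInner_eq_sum (A B : CutoffOp m N) :
    hsInner A B = ∑ n, ⟪A (EuclideanSpace.basisFun (CutoffOcc m N) ℂ n),
      B (EuclideanSpace.basisFun (CutoffOcc m N) ℂ n)⟫_ℂ := by
  rw [hsInner, tr, LinearMap.trace_eq_sum_inner _ (EuclideanSpace.basisFun (CutoffOcc m N) ℂ)]
  refine Finset.sum_congr rfl fun n _ => ?_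
  rw [ContinuousLinearMap.coe_coe, mul_apply_eq_comp, ContinuousLinearMap.star_eq_adjoint,
    ContinuousLinearMap.adjoint_inner_right]

lemma operatorRank_eq_rank_operatorGram (ρ : CutoffOp m N) :
    operatorRank ρ = (operatorGram ρ).rank := by
  let B : CutoffOp m N →ₗ[ℝ] CutoffOp m N →ₗ[ℝ] ℝ :=
    LinearMap.mk₂ ℝ (fun x y => (hsInner x y).re)
      (fun x y z => by simp [hsInner_eq_sum, Finset.sum_add_distrib])
      (fun c x y => by
        simp only [hsInner_eq_sum]
        rw [← Complex.coe_smul]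
        simp [Finset.mul_sum])
      (fun x y z => by simp [hsInner_eq_sum, Finset.sum_add_distrib])
      (fun c x y => by
        simp only [hsInner_eq_sum]
        rw [← Complex.coe_smul]
        simp [Finset.mul_sum])
  refine finrank_range_eq_rank_gram B (fun x hx => ?_) _
  have h1 : (hsInner x x).re = 0 := hx
  have h0 : ∀ y : CutoffSpace m N, 0 ≤ (⟪y, y⟫_ℂ).re := fun y => inner_self_nonneg (𝕜 := ℂ)
  rw [hsInner_eq_sum, Complex.re_sum, Finset.sum_eq_zero_iff_of_nonneg fun n _ => h0 _] at h1
  have h2 : (x : CutoffSpace m N →ₗ[ℂ] CutoffSpace m N) = 0 := by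
    refine (EuclideanSpace.basisFun (CutoffOcc m N) ℂ).toBasis.ext fun n => ?_
    have h3 := h1 n (Finset.mem_univ n)
    have h4 := inner_self_eq_norm_sq (𝕜 := ℂ) (x (EuclideanSpace.basisFun (CutoffOcc m N) ℂ n))
    rw [RCLike.re_eq_complex_re, h3] at h4
    simpa using h4.symm
  ext1 y
  exact LinearMap.congr_fun h2 y

end Gram

/-! ### The conjugation action on operators. -/

section Conjugation

variable {A B : Type*} [NormedRing A] [NormedAlgebra ℝ A] [NormedRing B] [NormedAlgebra ℝ B]
  [StarRing B] [NormedStarGroup B] [StarModule ℝ B]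

/-- The real-linear action `b ↦ R u * b * star (R u)` defined by a homomorphism `R`. -/
def conjugationAction (R : A →* B) : A →* (B →L[ℝ] B) where
  toFun u := ContinuousLinearMap.mulLeftRight ℝ B (R u) (star (R u))
  map_one' := by ext1 b; simp
  map_mul' u w := by ext1 b; simp [mul_assoc]

lemma contDiff_conjugationAction {R : A →* B} (hR : ContDiff ℝ ω R) :
    ContDiff ℝ ω (conjugationAction R) := by
  have h2 : ContDiff ℝ ω fun u => star (R u) := (starL' ℝ : B ≃L[ℝ] B).contDiff.comp hR
  exact (ContinuousLinearMap.isBoundedBilinearMap (E := B) (F := B) (G := B →L[ℝ] B)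
    (ContinuousLinearMap.mulLeftRight ℝ B)).contDiff.comp₂ hR h2

lemma exists_hasFDerivAt_conjugationAction {R : A →* B} {R' : A →L[ℝ] B}
    (hR : HasFDerivAt R R' 1) : ∃ D : A →L[ℝ] B →L[ℝ] B,
      HasFDerivAt (conjugationAction R) D 1 ∧ ∀ x b, D x b = R' x * b + b * star (R' x) := by
  have h2 : HasFDerivAt (fun u => star (R u)) ((starL' ℝ : B ≃L[ℝ] B).toContinuousLinearMap ∘L R')
      1 :=
    (starL' ℝ : B ≃L[ℝ] B).hasFDerivAt.comp 1 hR
  refine ⟨_, ContinuousLinearMap.hasFDerivAt_of_bilinear (E := B) (F := B) (G := B →L[ℝ] B)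
    (ContinuousLinearMap.mulLeftRight ℝ B) hR h2, fun x b => ?_⟩
  simp [add_comm]

end Conjugation

/-! ### The orbits of kets and of operators. -/

section Orbits

open scoped Matrix.Norms.L2Operator

variable {m N : ℕ}

/-- The real-linear action of matrices on kets. -/
def ketAction (m N : ℕ) :
    Matrix (Fin m) (Fin m) ℂ →* (CutoffSpace m N →L[ℝ] CutoffSpace m N) where
  toFun u := (rep m N u).restrictScalars ℝ
  map_one' := by rw [map_one]; rfl
  map_mul' u w := by rw [map_mul]; rfl

lemma hasFDerivAt_rep (m N : ℕ) : HasFDerivAt (rep m N) (fderiv ℝ (rep m N) 1) 1 :=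
  ((contDiff_rep m N).differentiable (by simp)).differentiableAt.hasFDerivAt

instance : FiniteDimensional ℝ (Matrix (Fin m) (Fin m) ℂ) := FiniteDimensional.complexToReal _

instance : FiniteDimensional ℝ (CutoffSpace m N) := FiniteDimensional.complexToReal _

instance : FiniteDimensional ℝ (CutoffOp m N) := FiniteDimensional.complexToReal _

lemma isEmbeddedSubmanifold_ketOrbit (ψ : CutoffSpace m N) :
    IsEmbeddedSubmanifold (ketOrbit ψ) (ketRank ψ) := by
  let ρ := ContinuousLinearMap.restrictScalarsL ℂ (CutoffSpace m N) (CutoffSpace m N) ℝ ℝ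
  have h := isEmbeddedSubmanifold_orbit generator_mem_skewAdjoint (fun _ => mem_span_generator)
    (R := ketAction m N) (R' := ρ ∘L fderiv ℝ (rep m N) 1) (ρ.contDiff.comp (contDiff_rep m N))
    (ρ.hasFDerivAt.comp 1 (hasFDerivAt_rep m N)) ψ
  have h1 : {w | ∃ u ∈ expProducts (generator (m := m)), w = ketAction m N u ψ}
      = ketOrbit ψ := by
    ext w
    simp only [ketOrbit, ploGroup_eq_image, Set.mem_ofPred_eq, Set.exists_mem_image]
    rfl
  have h2 : (fun I => (ρ ∘L fderiv ℝ (rep m N) 1) (generator I) ψ)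
      = fun I : PLOIndex m => negIEquiv _ ((cutoffHamiltonian I : CutoffOp m N) ψ) := by
    funext I
    rw [ContinuousLinearMap.comp_apply, fderiv_rep_generator]
    rfl
  rw [h1, h2, finrank_range_linearEquiv] at h
  exact h

lemma isEmbeddedSubmanifold_operatorOrbit (σ : CutoffOp m N) :
    IsEmbeddedSubmanifold (operatorOrbit σ) (operatorRank σ) := by
  obtain ⟨D, hD, hD'⟩ := exists_hasFDerivAt_conjugationAction (hasFDerivAt_rep m N)
  have h := isEmbeddedSubmanifold_orbit generator_mem_skewAdjoint (fun _ => mem_span_generator)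
    (contDiff_conjugationAction (contDiff_rep m N)) hD σ
  have h1 : {w | ∃ u ∈ expProducts (generator (m := m)), w = conjugationAction (rep m N) u σ}
      = operatorOrbit σ := by
    ext w
    simp only [operatorOrbit, ploGroup_eq_image, Set.mem_ofPred_eq, Set.exists_mem_image]
    rfl
  -- With `R' x = -i H` and `H` self-adjoint, `R' x * σ + σ * star (R' x)` becomes `-i [H, σ]`.
  have h2 : (fun I => D (generator I) σ)
      = fun I : PLOIndex m => negIEquiv _ ⁅(cutoffHamiltonian I : CutoffOp m N), σ⁆ := by
    funext I
    rw [hD', fderiv_rep_generator, star_smul, star_cutoffHamiltonian, negIEquiv_apply, Ring.lie_def]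
    have h3 : star (-Complex.I) = Complex.I := by simp
    rw [h3, smul_mul_assoc, mul_smul_comm, smul_sub, neg_smul, neg_smul, sub_neg_eq_add]
    congr 1
    exact neg_smul (M := CutoffOp m N) _ _
  rw [h1, h2, finrank_range_linearEquiv] at h
  exact h

end Orbits

end QuantumOptics

end

theorem theorem1 (m N : ℕ) :
    (∀ ψ : QuantumOptics.CutoffSpace m N, ‖ψ‖ = 1 →
      QuantumOptics.IsEmbeddedSubmanifold (QuantumOptics.ketOrbit ψ) (QuantumOptics.ketRank ψ) ∧
      QuantumOptics.ketRank ψ = (QuantumOptics.ketGram ψ).rank) ∧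
    (∀ ρ : QuantumOptics.CutoffOp m N, QuantumOptics.IsDensityOperator ρ →
      QuantumOptics.IsEmbeddedSubmanifold
        (QuantumOptics.operatorOrbit ρ) (QuantumOptics.operatorRank ρ) ∧
      QuantumOptics.operatorRank ρ = (QuantumOptics.operatorGram ρ).rank) :=
  ⟨fun ψ _ => ⟨QuantumOptics.isEmbeddedSubmanifold_ketOrbit ψ,
      QuantumOptics.ketRank_eq_rank_ketGram ψ⟩,
    fun ρ _ => ⟨QuantumOptics.isEmbeddedSubmanifold_operatorOrbit ρ,
      QuantumOptics.operatorRank_eq_rank_operatorGram ρ⟩⟩
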